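/- Let $\Omega\subset\mathbb{R}^N$ be an unbounded domain (open, connected, non-empty), let $a\in C(\overline\Omega)\cap L^\infty(\Omega)$ be real-valued, and let $K:\Omega\times\Omega\to[0,\infty)$ be such that $K(x,\cdot)$ is measurable for every $x\in\Omega$ and $K(\cdot,y)$ is uniformly continuous on $\Omega$ for almost every $y\in\Omega$. Assume moreover that there are constants $r_0\ge r_1>0$ and $C_0\ge c_0>0$ such that $$C_0\,\mathbf 1_{\Omega\cap B_{r_0}(x)}(y)\ \ge\ K(x,y)\ \ge\ c_0\,\mathbf 1_{\Omega\cap B_{r_1}(x)}(y)\qquad\text{for all }x,y\in\Omega,$$ where $B_r(x)$ is the ball of radius $r$ centred at $x$. Let $\mathcal L_\Omega[\varphi](x):=\int_\Omega K(x,y)\varphi(y)\,dy$ and define $$\lambda_p:=\sup\{\lambda\in\mathbb{R} : \exists\,\varphi\in C(\overline\Omega),\ \varphi>0\text{ on }\overline\Omega,\ \mathcal L_\Omega[\varphi]+a\varphi+\lambda\varphi\le 0\text{ in }\Omega\},$$ $$\lambda_p':=\inf\{\lambda\in\mathbb{R} : \exists\,\varphi\in C(\Omega)\cap L^\infty(\Omega),\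 \varphi\ge 0,\ \varphi\not\equiv 0,\ \mathcal L_\Omega[\varphi]+(a+\lambda)\varphi\ge 0\text{ in }\Omega\},$$ $$\lambda_p'':=\inf\{\lambda\in\mathbb{R} : \exists\,\varphi\in C_c(\Omega),\ \varphi\ge 0,\ \varphi\not\equiv 0,\ \mathcal L_\Omega[\varphi]+(a+\lambda)\varphi\ge 0\text{ in }\Omega\},$$ $$\lambda_v:=\inf_{\varphi\in L^2(\Omega),\ \varphi\not\equiv 0}\ -\frac{\langle \mathcal L_\Omega[\varphi]+a\varphi,\varphi\rangle_{L^2(\Omega)}}{\|\varphi\|_{L^2(\Omega)}^2}.$$ Here $C_c(\Omega)$ is the space of continuous functions with compact support contained in $\Omega$. Then $$\lambda_p'\le\lambda_p''\le\lambda_p.$$ If in addition $K$ is symmetric, i.e. $K(x,y)=K(y,x)$ for all $x,y\in\Omega$, and $p(x):=\int_\Omega K(x,y)\,dy$ belongs to $L^\infty(\Omega)$, then $$\lambda_v=\lambda_p'=\lambda_p''=\lambda_p.$$ -/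

import Mathlib

open MeasureTheory Set

noncomputable section

namespace NonlocalEigenvalue

variable {N : ℕ}

/-- The nonlocal operator `L_Ω`: `L_Ω[φ](x) = ∫_Ω K(x,y) φ(y) dy`. -/
def nonlocalOp (Ω : Set (EuclideanSpace ℝ (Fin N)))
    (K : EuclideanSpace ℝ (Fin N) → EuclideanSpace ℝ (Fin N) → ℝ)
    (φ : EuclideanSpace ℝ (Fin N) → ℝ) (x : EuclideanSpace ℝ (Fin N)) : ℝ :=
  ∫ y in Ω, K x y * φ y

/-- `a ∈ C(closure Ω) ∩ L^∞(Ω)`. For a function that is continuous on the open set `Ω`,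
being essentially bounded and being bounded are the same. -/
def IsAdmissiblePotential (Ω : Set (EuclideanSpace ℝ (Fin N)))
    (a : EuclideanSpace ℝ (Fin N) → ℝ) : Prop :=
  ContinuousOn a (closure Ω) ∧ ∃ M : ℝ, ∀ x ∈ Ω, |a x| ≤ M

/-- `K` is a nonnegative Caratheodory function on `Ω × Ω`: `K(x,·)` is (Lebesgue) measurable on `Ω`
for every `x ∈ Ω` and `K(·,y)` is uniformly continuous on `Ω` for almost every `y ∈ Ω`. -/
def IsNonnegCaratheodory (Ω : Set (EuclideanSpace ℝ (Fin N)))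
    (K : EuclideanSpace ℝ (Fin N) → EuclideanSpace ℝ (Fin N) → ℝ) : Prop :=
  (∀ x ∈ Ω, ∀ y ∈ Ω, 0 ≤ K x y) ∧
  (∀ x ∈ Ω, AEMeasurable (fun y => K x y) (volume.restrict Ω)) ∧
  (∀ᵐ y ∂(volume.restrict Ω), UniformContinuousOn (fun x => K x y) Ω)

/-- The non-degeneracy condition: there are `r₀ ≥ r₁ > 0` and `C₀ ≥ c₀ > 0` such that
`c₀ 1_{Ω ∩ B_{r₁}(x)}(y) ≤ K(x,y) ≤ C₀ 1_{Ω ∩ B_{r₀}(x)}(y)` for all `x, y ∈ Ω`. -/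
def IsNondegenerate (Ω : Set (EuclideanSpace ℝ (Fin N)))
    (K : EuclideanSpace ℝ (Fin N) → EuclideanSpace ℝ (Fin N) → ℝ) : Prop :=
  ∃ r₀ r₁ C₀ c₀ : ℝ, 0 < r₁ ∧ r₁ ≤ r₀ ∧ 0 < c₀ ∧ c₀ ≤ C₀ ∧
    ∀ x ∈ Ω, ∀ y ∈ Ω,
      K x y ≤ C₀ * (Ω ∩ Metric.ball x r₀).indicator (fun _ => (1 : ℝ)) y ∧
      c₀ * (Ω ∩ Metric.ball x r₁).indicator (fun _ => (1 : ℝ)) y ≤ K x y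

/-- `λ_p(L_Ω + a)`: the supremum of the `μ ∈ ℝ` for which there is a positive `φ ∈ C(closure Ω)`
with `L_Ω[φ] + a φ + μ φ ≤ 0` in `Ω`. -/
def lambdaP (Ω : Set (EuclideanSpace ℝ (Fin N)))
    (K : EuclideanSpace ℝ (Fin N) → EuclideanSpace ℝ (Fin N) → ℝ)
    (a : EuclideanSpace ℝ (Fin N) → ℝ) : EReal :=
  sSup ((fun μ : ℝ => (μ : EReal)) '' {μ : ℝ | ∃ φ : EuclideanSpace ℝ (Fin N) → ℝ,
    ContinuousOn φ (closure Ω) ∧ (∀ x ∈ closure Ω, 0 < φ x) ∧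
    ∀ x ∈ Ω, nonlocalOp Ω K φ x + a x * φ x + μ * φ x ≤ 0})

/-- `λ_p'(L_Ω + a)`: the infimum of the `μ ∈ ℝ` for which there is a nonnegative
`φ ∈ C(Ω) ∩ L^∞(Ω)`, not identically zero, with `L_Ω[φ] + (a + μ) φ ≥ 0` in `Ω`. -/
def lambdaPPrime (Ω : Set (EuclideanSpace ℝ (Fin N)))
    (K : EuclideanSpace ℝ (Fin N) → EuclideanSpace ℝ (Fin N) → ℝ)
    (a : EuclideanSpace ℝ (Fin N) → ℝ) : EReal :=
  sInf ((fun μ : ℝ => (μ : EReal)) '' {μ : ℝ | ∃ φ : EuclideanSpace ℝ (Fin N) → ℝ,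
    ContinuousOn φ Ω ∧ (∃ M : ℝ, ∀ x ∈ Ω, |φ x| ≤ M) ∧
    (∀ x ∈ Ω, 0 ≤ φ x) ∧ (∃ x ∈ Ω, φ x ≠ 0) ∧
    ∀ x ∈ Ω, 0 ≤ nonlocalOp Ω K φ x + (a x + μ) * φ x})

/-- `λ_p''(L_Ω + a)`: as `λ_p'`, with test functions `φ ∈ C_c(Ω)`, that is, continuous functions
whose support is compact and contained in `Ω`. -/
def lambdaPSecond (Ω : Set (EuclideanSpace ℝ (Fin N)))
    (K : EuclideanSpace ℝ (Fin N) → EuclideanSpace ℝ (Fin N) → ℝ)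
    (a : EuclideanSpace ℝ (Fin N) → ℝ) : EReal :=
  sInf ((fun μ : ℝ => (μ : EReal)) '' {μ : ℝ | ∃ φ : EuclideanSpace ℝ (Fin N) → ℝ,
    Continuous φ ∧ HasCompactSupport φ ∧ tsupport φ ⊆ Ω ∧
    (∀ x ∈ Ω, 0 ≤ φ x) ∧ (∃ x ∈ Ω, φ x ≠ 0) ∧
    ∀ x ∈ Ω, 0 ≤ nonlocalOp Ω K φ x + (a x + μ) * φ x})

/-- `λ_v(L_Ω + a)`: the infimum over the nonzero `φ ∈ L²(Ω)` of
`- ⟨L_Ω[φ] + a φ, φ⟩ / ‖φ‖²`, with the scalar product and the norm of `L²(Ω)`. -/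
def lambdaV (Ω : Set (EuclideanSpace ℝ (Fin N)))
    (K : EuclideanSpace ℝ (Fin N) → EuclideanSpace ℝ (Fin N) → ℝ)
    (a : EuclideanSpace ℝ (Fin N) → ℝ) : EReal :=
  sInf ((fun φ : EuclideanSpace ℝ (Fin N) → ℝ =>
      ((-((∫ x in Ω, (nonlocalOp Ω K φ x + a x * φ x) * φ x) / ∫ x in Ω, φ x ^ 2) : ℝ) : EReal)) ''
    {φ | MemLp φ 2 (volume.restrict Ω) ∧ ¬ φ =ᵐ[volume.restrict Ω] 0})

end NonlocalEigenvalue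

end

/-!
The inequality `λ_p' ≤ λ_p''` holds because functions in `C_c(Ω)` are bounded.

For `λ_p'' ≤ λ_p`, let `l < l' < λ_p''`. A bump in the set `a + l' > 0` would be a subsolution, so that
set is empty and `b = -(a + l)` is bounded between positive constants. Put `T g = L_Ω[g] / b`; the
choice of `l'` says that no nonzero `0 ≤ φ ∈ C_c(Ω)` satisfies `T φ ≥ q φ`, for some `q < 1`. The
positive supersolution for `l` is the Green function `u = ∑ Tᵏ f` of a small bump `f`, which
satisfies `u = f + T u`. It has to be shown finite, without any spectral theory. With `T` multiplied
by a cut-off function, the truncated sum `φ = ∑_{k ≤ m} q⁻ᵏ Tᵏ f` lies in `C_c(Ω)`, and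
`T φ ≥ q φ` would follow from `q^{-(m+1)} T^{m+1} f ≥ f`; hence `T^{m+1} f < q^{m+1} f` somewhere on
the support of `f` (`IsFiniteRangeKernel.exists_greenIterate_lt`). The lower bound on `K` turns this
into geometric decay of `∫ Tᵐ f` over the support of `f`, with constants independent of the cut-off
(`IsFiniteRangeKernel.setIntegral_greenIterate_le`). The inequality `u(x) ≥ κ ∫_{Ω ∩ B_{r₁}(x)} u`
propagates the integrability of `u` through the connected set `Ω`
(`lintegral_ball_lt_top_of_le`), and in the same way its positivity. Uniform continuity of `K(·, y)`
and dominated convergence extend `u` continuously to the closure.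

For symmetric `K`, it remains to compare with `λ_v`. If `φ > 0` is a supersolution, Young's
inequality `2 ψ(x) ψ(y) ≤ φ(y) / φ(x) ψ(x)² + φ(x) / φ(y) ψ(y)²` and Tonelli give
`⟨L_Ω[ψ], ψ⟩ ≤ ∫ (L_Ω[φ] / φ) ψ²`, so `λ_p ≤ λ_v`. If `φ` is a bounded subsolution, then `w φ` with
the integrable weight `w(x) = (1 + η ‖x‖)^{-(N+1)}` lies in `L²(Ω)`; since `w` varies by a factor
close to `1` over the range of the kernel, `w φ` is pointwise an approximate subsolution, so
`λ_v ≤ λ_p'`.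
-/

noncomputable section

namespace NonlocalEigenvalue

variable {N : ℕ}

open Filter Topology

/-! ### Kernels of finite range -/

/-- A nonnegative Carathéodory kernel on `Ω × Ω` with fixed constants in the non-degeneracy
condition: it is bounded by `C₀`, vanishes at distance at least `r₀` from the diagonal, and is at
least `c₀` at distance less than `r₁`. -/
structure IsFiniteRangeKernel (Ω : Set (EuclideanSpace ℝ (Fin N)))
    (K : EuclideanSpace ℝ (Fin N) → EuclideanSpace ℝ (Fin N) → ℝ) (r₀ r₁ C₀ c₀ : ℝ) : Prop where
  isOpen : IsOpen Ω
  r₁_pos : 0 < r₁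
  r₁_le : r₁ ≤ r₀
  c₀_pos : 0 < c₀
  c₀_le : c₀ ≤ C₀
  nonneg : ∀ x ∈ Ω, ∀ y ∈ Ω, 0 ≤ K x y
  aemeasurable : ∀ x ∈ Ω, AEMeasurable (fun y => K x y) (volume.restrict Ω)
  uniformContinuousOn : ∀ᵐ y ∂(volume.restrict Ω), UniformContinuousOn (fun x => K x y) Ω
  le : ∀ x ∈ Ω, ∀ y ∈ Ω, K x y ≤ C₀
  eq_zero : ∀ x ∈ Ω, ∀ y ∈ Ω, r₀ ≤ dist y x → K x y = 0
  ge : ∀ x ∈ Ω, ∀ y ∈ Ω, dist y x < r₁ → c₀ ≤ K x y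

lemma IsNondegenerate.exists_isFiniteRangeKernel {Ω : Set (EuclideanSpace ℝ (Fin N))}
    {K : EuclideanSpace ℝ (Fin N) → EuclideanSpace ℝ (Fin N) → ℝ}
    (h : IsNondegenerate Ω K) (hK : IsNonnegCaratheodory Ω K) (hΩ : IsOpen Ω) :
    ∃ r₀ r₁ C₀ c₀ : ℝ, IsFiniteRangeKernel Ω K r₀ r₁ C₀ c₀ := by
  obtain ⟨r₀, r₁, C₀, c₀, hr₁, hr, hc₀, hc, hb⟩ := h
  refine ⟨r₀, r₁, C₀, c₀, hΩ, hr₁, hr, hc₀, hc, hK.1, hK.2.1, hK.2.2, ?_, ?_, ?_⟩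
  · intro x hx y hy
    refine (hb x hx y hy).1.trans ?_
    by_cases hxy : y ∈ Ω ∩ Metric.ball x r₀
    · simp [indicator_of_mem hxy]
    · simpa [indicator_of_notMem hxy] using hc₀.le.trans hc
  · intro x hx y hy hxy
    have h1 := (hb x hx y hy).1
    rw [indicator_of_notMem (by simp [hxy]), mul_zero] at h1
    exact le_antisymm h1 (hK.1 x hx y hy)
  · intro x hx y hy hxy
    have h1 := (hb x hx y hy).2
    rwa [indicator_of_mem (by simp [hxy, hy]), mul_one] at h1

/-- Functions on `Ω` that are integrable on the bounded parts of `Ω`: the natural domain of an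
operator whose kernel has finite range. -/
structure IntegrableOnBounded (Ω : Set (EuclideanSpace ℝ (Fin N)))
    (g : EuclideanSpace ℝ (Fin N) → ℝ) : Prop where
  aestronglyMeasurable : AEStronglyMeasurable g (volume.restrict Ω)
  integrableOn : ∀ z R, IntegrableOn g (Ω ∩ Metric.ball z R)

section
variable {Ω : Set (EuclideanSpace ℝ (Fin N))} {g : EuclideanSpace ℝ (Fin N) → ℝ}
  {K : EuclideanSpace ℝ (Fin N) → EuclideanSpace ℝ (Fin N) → ℝ} {r₀ r₁ C₀ c₀ : ℝ}

lemma IntegrableOnBounded.of_bound (hΩ : IsOpen Ω)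
    (hg : AEStronglyMeasurable g (volume.restrict Ω)) {B : ℝ} (hB : ∀ x ∈ Ω, |g x| ≤ B) :
    IntegrableOnBounded Ω g := by
  refine ⟨hg, fun z R => ?_⟩
  refine IntegrableOn.of_bound ?_ (hg.mono_set inter_subset_left) B ?_
  · exact (measure_mono inter_subset_right).trans_lt measure_ball_lt_top
  · refine (ae_restrict_iff' (hΩ.measurableSet.inter measurableSet_ball)).2 (.of_forall ?_)
    exact fun x hx => hB x hx.1

lemma IntegrableOnBounded.of_memLp (hg : MemLp g 2 (volume.restrict Ω)) :
    IntegrableOnBounded Ω g := by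
  refine ⟨hg.1, fun z R => ?_⟩
  have : IsFiniteMeasure (volume.restrict (Ω ∩ Metric.ball z R)) :=
    ⟨by simpa using (measure_mono inter_subset_right).trans_lt measure_ball_lt_top⟩
  exact (hg.mono_measure (Measure.restrict_mono inter_subset_left le_rfl)).integrable one_le_two

lemma IntegrableOnBounded.of_continuousOn_closure (hΩ : IsOpen Ω)
    (hg : ContinuousOn g (closure Ω)) : IntegrableOnBounded Ω g := by
  refine ⟨(hg.mono subset_closure).aestronglyMeasurable hΩ.measurableSet, fun z R => ?_⟩
  have hc : IsCompact (closure Ω ∩ Metric.closedBall z R) :=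
    (isCompact_closedBall z R).inter_left isClosed_closure
  exact ((hg.mono inter_subset_left).integrableOn_compact hc).mono_set
    (inter_subset_inter subset_closure Metric.ball_subset_closedBall)

lemma IntegrableOnBounded.of_continuousOn_bound (hΩ : IsOpen Ω)
    (hg : ContinuousOn g Ω) {B : ℝ} (hB : ∀ x ∈ Ω, |g x| ≤ B) : IntegrableOnBounded Ω g :=
  .of_bound hΩ (hg.aestronglyMeasurable hΩ.measurableSet) hB

lemma IntegrableOnBounded.of_continuous (hΩ : IsOpen Ω) (hg : Continuous g) :
    IntegrableOnBounded Ω g :=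
  .of_continuousOn_closure hΩ hg.continuousOn

namespace IsFiniteRangeKernel

lemma C₀_pos (hK : IsFiniteRangeKernel Ω K r₀ r₁ C₀ c₀) : 0 < C₀ := hK.c₀_pos.trans_le hK.c₀_le

lemma r₀_pos (hK : IsFiniteRangeKernel Ω K r₀ r₁ C₀ c₀) : 0 < r₀ := hK.r₁_pos.trans_le hK.r₁_le

lemma abs_mul_le_indicator (hK : IsFiniteRangeKernel Ω K r₀ r₁ C₀ c₀)
    {x y z : EuclideanSpace ℝ (Fin N)} (hx : x ∈ Ω) (hy : y ∈ Ω) {R : ℝ}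
    (hR : r₀ + dist x z ≤ R) :
    |K x y * g y| ≤ (Metric.ball z R).indicator (fun y => C₀ * |g y|) y := by
  by_cases hyz : y ∈ Metric.ball z R
  · rw [indicator_of_mem hyz, abs_mul, abs_of_nonneg (hK.nonneg x hx y hy)]
    exact mul_le_mul_of_nonneg_right (hK.le x hx y hy) (abs_nonneg _)
  · rw [indicator_of_notMem hyz, hK.eq_zero x hx y hy, zero_mul, abs_zero]
    have h1 := dist_triangle y x z
    have h2 : R ≤ dist y z := by simpa using hyz
    linarith

lemma integrable_indicator_ball (hg : IntegrableOnBounded Ω g)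
    (z : EuclideanSpace ℝ (Fin N)) (R : ℝ) :
    Integrable ((Metric.ball z R).indicator (fun y => C₀ * |g y|)) (volume.restrict Ω) := by
  rw [integrable_indicator_iff measurableSet_ball, IntegrableOn,
    Measure.restrict_restrict measurableSet_ball, inter_comm]
  exact (hg.integrableOn z R).abs.const_mul _

lemma integrableOn_mul (hK : IsFiniteRangeKernel Ω K r₀ r₁ C₀ c₀) (hg : IntegrableOnBounded Ω g)
    {x : EuclideanSpace ℝ (Fin N)} (hx : x ∈ Ω) : IntegrableOn (fun y => K x y * g y) Ω := by
  refine (integrable_indicator_ball (C₀ := C₀) hg x (r₀ + dist x x)).mono'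
    ((hK.aemeasurable x hx).aestronglyMeasurable.mul hg.aestronglyMeasurable) ?_
  refine (ae_restrict_iff' hK.isOpen.measurableSet).2 (.of_forall fun y hy => ?_)
  exact hK.abs_mul_le_indicator hx hy le_rfl

lemma nonlocalOp_nonneg (hK : IsFiniteRangeKernel Ω K r₀ r₁ C₀ c₀) (hg : ∀ y ∈ Ω, 0 ≤ g y)
    {x : EuclideanSpace ℝ (Fin N)} (hx : x ∈ Ω) : 0 ≤ nonlocalOp Ω K g x :=
  setIntegral_nonneg hK.isOpen.measurableSet fun y hy => mul_nonneg (hK.nonneg x hx y hy) (hg y hy)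

/-- The lower bound on the kernel: `L_Ω[g](x)` controls the integral of `g` near `x`. -/
lemma mul_setIntegral_le_nonlocalOp (hK : IsFiniteRangeKernel Ω K r₀ r₁ C₀ c₀)
    (hg : IntegrableOnBounded Ω g) (hg0 : ∀ y ∈ Ω, 0 ≤ g y)
    {x : EuclideanSpace ℝ (Fin N)} (hx : x ∈ Ω) {s : Set (EuclideanSpace ℝ (Fin N))}
    (hs : MeasurableSet s) (hsΩ : s ⊆ Ω) (hsx : s ⊆ Metric.ball x r₁) :
    c₀ * ∫ y in s, g y ≤ nonlocalOp Ω K g x := by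
  rw [← integral_const_mul]
  calc ∫ y in s, c₀ * g y ≤ ∫ y in s, K x y * g y := by
        refine setIntegral_mono_on ?_ ((hK.integrableOn_mul hg hx).mono_set hsΩ) hs fun y hy =>
          mul_le_mul_of_nonneg_right (hK.ge x hx y (hsΩ hy) (hsx hy)) (hg0 y (hsΩ hy))
        exact ((hg.integrableOn x r₁).mono_set (subset_inter hsΩ hsx)).const_mul _
    _ ≤ ∫ y in Ω, K x y * g y := by
        refine setIntegral_mono_set (hK.integrableOn_mul hg hx) ?_ (Eventually.of_forall hsΩ)
        refine (ae_restrict_iff' hK.isOpen.measurableSet).2 (.of_forall fun y hy => ?_)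
        exact mul_nonneg (hK.nonneg x hx y hy) (hg0 y hy)

lemma abs_nonlocalOp_le (hK : IsFiniteRangeKernel Ω K r₀ r₁ C₀ c₀) {B : ℝ}
    (hB : ∀ x ∈ Ω, |g x| ≤ B)
    {x : EuclideanSpace ℝ (Fin N)} (hx : x ∈ Ω) :
    |nonlocalOp Ω K g x| ≤
      C₀ * volume.real (Metric.ball (0 : EuclideanSpace ℝ (Fin N)) r₀) * B := by
  have hB0 : 0 ≤ B := (abs_nonneg _).trans (hB x hx)
  have hi : Integrable ((Metric.ball x r₀).indicator fun _ => C₀ * B)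
      (volume : Measure (EuclideanSpace ℝ (Fin N))) :=
    (integrable_indicator_iff measurableSet_ball).2
      (integrableOn_const measure_ball_lt_top.ne)
  calc |nonlocalOp Ω K g x| ≤ ∫ y in Ω, (Metric.ball x r₀).indicator (fun _ => C₀ * B) y := by
        refine norm_integral_le_of_norm_le (f := fun y => K x y * g y) hi.integrableOn ?_
        refine (ae_restrict_iff' hK.isOpen.measurableSet).2 (.of_forall fun y hy => ?_)
        refine (hK.abs_mul_le_indicator hx hy (z := x) (R := r₀) (by simp)).trans ?_
        refine indicator_le_indicator ?_
        exact mul_le_mul_of_nonneg_left (hB y hy) hK.C₀_pos.le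
    _ ≤ ∫ y, (Metric.ball x r₀).indicator (fun _ => C₀ * B) y := by
        refine setIntegral_le_integral hi (.of_forall fun y => ?_)
        exact indicator_nonneg (fun _ _ => mul_nonneg hK.C₀_pos.le hB0) y
    _ = C₀ * volume.real (Metric.ball (0 : EuclideanSpace ℝ (Fin N)) r₀) * B := by
        rw [integral_indicator measurableSet_ball, setIntegral_const, smul_eq_mul, measureReal_def,
          measureReal_def, Measure.addHaar_ball_center]
        ring

/-- Dominated convergence under `L_Ω`; the finite range provides the dominating function. -/
lemma tendsto_nonlocalOp (hK : IsFiniteRangeKernel Ω K r₀ r₁ C₀ c₀) (hg : IntegrableOnBounded Ω g)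
    {z : EuclideanSpace ℝ (Fin N)} {k : EuclideanSpace ℝ (Fin N) → ℝ}
    (hk : ∀ᵐ y ∂(volume.restrict Ω), Tendsto (fun x => K x y) (𝓝[Ω] z) (𝓝 (k y))) :
    Tendsto (nonlocalOp Ω K g) (𝓝[Ω] z) (𝓝 (∫ y in Ω, k y * g y)) := by
  have hmem : ∀ᶠ x in 𝓝[Ω] z, x ∈ Ω := eventually_mem_nhdsWithin
  have hball : ∀ᶠ x in 𝓝[Ω] z, dist x z < 1 :=
    eventually_nhdsWithin_of_eventually_nhds (Metric.ball_mem_nhds z one_pos)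
  refine tendsto_integral_filter_of_dominated_convergence
    ((Metric.ball z (r₀ + 1)).indicator (fun y => C₀ * |g y|)) ?_ ?_
    (integrable_indicator_ball hg z (r₀ + 1)) ?_
  · filter_upwards [hmem] with x hx using (hK.integrableOn_mul hg hx).1
  · filter_upwards [hmem, hball] with x hx hxz
    refine (ae_restrict_iff' hK.isOpen.measurableSet).2 (.of_forall fun y hy => ?_)
    exact hK.abs_mul_le_indicator hx hy (by linarith)
  · filter_upwards [hk] with y hy using hy.mul_const _

lemma continuousOn_nonlocalOp (hK : IsFiniteRangeKernel Ω K r₀ r₁ C₀ c₀)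
    (hg : IntegrableOnBounded Ω g) : ContinuousOn (nonlocalOp Ω K g) Ω := by
  intro z hz
  refine hK.tendsto_nonlocalOp hg ?_
  filter_upwards [hK.uniformContinuousOn] with y hy using hy.continuousOn z hz

/-- Uniform continuity of `K(·, y)` is what makes `L_Ω[g]` extend continuously to `∂Ω`. -/
lemma exists_tendsto_nonlocalOp (hK : IsFiniteRangeKernel Ω K r₀ r₁ C₀ c₀)
    (hg : IntegrableOnBounded Ω g) {z : EuclideanSpace ℝ (Fin N)} (hz : z ∈ closure Ω) :
    ∃ l, Tendsto (nonlocalOp Ω K g) (𝓝[Ω] z) (𝓝 l) := by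
  have hne : (𝓝[Ω] z).NeBot := mem_closure_iff_nhdsWithin_neBot.1 hz
  have hlim : ∀ y, ∃ l : ℝ, UniformContinuousOn (fun x => K x y) Ω →
      Tendsto (fun x => K x y) (𝓝[Ω] z) (𝓝 l) := by
    intro y
    by_cases hy : UniformContinuousOn (fun x => K x y) Ω
    · have hc : Cauchy (map (fun x => K x y) (𝓝[Ω] z)) := by
        refine ⟨hne.map _, ?_⟩
        rw [prod_map_map_eq]
        refine Tendsto.mono_left hy (le_inf ?_ ?_)
        · exact (cauchy_nhds.mono nhdsWithin_le_nhds).2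
        · exact le_principal_iff.2 (prod_mem_prod self_mem_nhdsWithin self_mem_nhdsWithin)
      obtain ⟨l, hl⟩ := CompleteSpace.complete hc
      exact ⟨l, fun _ => hl⟩
    · exact ⟨0, fun h => absurd h hy⟩
  choose k hk using hlim
  exact ⟨_, hK.tendsto_nonlocalOp hg (k := k)
    (hK.uniformContinuousOn.mono fun y hy => hk y hy)⟩

end IsFiniteRangeKernel
end

/-! ### Exhaustion of `Ω` and propagation of integrability -/

section
variable {Ω : Set (EuclideanSpace ℝ (Fin N))}

/-- Cut-off functions in `C_c(Ω)`, all equal to `1` on the given compact set, that are eventually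
`1` at every point of `Ω`. -/
lemma exists_cutoff_sequence (hΩ : IsOpen Ω) {Q : Set (EuclideanSpace ℝ (Fin N))}
    (hQ : IsCompact Q) (hQΩ : Q ⊆ Ω) :
    ∃ χ : ℕ → EuclideanSpace ℝ (Fin N) → ℝ, ∀ n, (Continuous (χ n) ∧ IsCompact (tsupport (χ n)) ∧
      tsupport (χ n) ⊆ Ω ∧ ∀ x, χ n x ∈ Icc 0 1) ∧ (∀ x ∈ Q, χ n x = 1) ∧
      ∀ x ∈ Ω, ∀ᶠ n in atTop, χ n x = 1 := by
  have : LocallyCompactSpace Ω := hΩ.locallyCompactSpace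
  let C : CompactExhaustion Ω := default
  have hC : ∀ n, IsCompact (Subtype.val '' C n) := fun n =>
    (C.isCompact n).image continuous_subtype_val
  have hCΩ : ∀ n, Subtype.val '' C n ⊆ Ω := fun n => by rintro _ ⟨x, -, rfl⟩; exact x.2
  choose χ h1 h2 h3 h4 using fun n => exists_continuousMap_one_of_isCompact_subset_isOpen
    ((hC n).union hQ) hΩ (union_subset (hCΩ n) hQΩ)
  refine ⟨fun n => χ n, fun n => ⟨⟨(χ n).continuous, h2 n, h3 n, h4 n⟩,
    fun x hx => h1 n (Or.inr hx), fun x hx => ?_⟩⟩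
  filter_upwards [eventually_ge_atTop (C.find ⟨x, hx⟩)] with m hm
  exact h1 m (Or.inl ⟨⟨x, hx⟩, C.mem_iff_find_le.2 hm, rfl⟩)

/-- A nonnegative function bounding from below its own integrals over balls of a fixed radius is
locally integrable up to the boundary of a connected `Ω` as soon as it is integrable near one
point. -/
lemma lintegral_ball_lt_top_of_le (hΩ : IsOpen Ω) (hconn : IsPreconnected Ω)
    {U : EuclideanSpace ℝ (Fin N) → ENNReal} (hU : AEMeasurable U (volume.restrict Ω))
    {κ : ENNReal} (hκ : κ ≠ 0) {r : ℝ} (hr : 0 < r)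
    (hle : ∀ x ∈ Ω, κ * ∫⁻ y in Metric.ball x r, U y ∂(volume.restrict Ω) ≤ U x)
    {x₀ : EuclideanSpace ℝ (Fin N)} (hx₀ : x₀ ∈ Ω) {ε₀ : ℝ} (hε₀ : 0 < ε₀)
    (hfin : ∫⁻ y in Metric.ball x₀ ε₀, U y ∂(volume.restrict Ω) < ⊤)
    (z : EuclideanSpace ℝ (Fin N)) (R : ℝ) :
    ∫⁻ y in Metric.ball z R, U y ∂(volume.restrict Ω) < ⊤ := by
  set ν := (volume.restrict Ω : Measure (EuclideanSpace ℝ (Fin N)))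
  let A : Set (EuclideanSpace ℝ (Fin N)) :=
    {x | ∃ ε > 0, ∫⁻ y in Metric.ball x ε, U y ∂ν < ⊤}
  have hA : IsOpen A := by
    refine Metric.isOpen_iff.2 fun x ⟨ε, hε, hx⟩ => ⟨ε / 2, half_pos hε, fun w hw => ?_⟩
    refine ⟨ε / 2, half_pos hε, (lintegral_mono_set ?_).trans_lt hx⟩
    refine Metric.ball_subset_ball' ?_
    have := Metric.mem_ball.1 hw
    linarith
  have key : ∀ x ∈ closure A ∩ Ω, ∫⁻ y in Metric.ball x (r / 2), U y ∂ν < ⊤ := by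
    rintro x ⟨hxA, hxΩ⟩
    obtain ⟨x', ⟨hx'Ω, hx'b⟩, ε, hε, hx'⟩ := mem_closure_iff.1 hxA
      (Ω ∩ Metric.ball x (r / 2)) (hΩ.inter Metric.isOpen_ball)
      ⟨hxΩ, Metric.mem_ball_self (half_pos hr)⟩
    have hG : IsOpen (Metric.ball x' ε ∩ (Ω ∩ Metric.ball x (r / 2))) :=
      Metric.isOpen_ball.inter (hΩ.inter Metric.isOpen_ball)
    set G := Metric.ball x' ε ∩ (Ω ∩ Metric.ball x (r / 2))
    have hGpos : volume G ≠ 0 :=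
      (hG.measure_pos volume ⟨x', Metric.mem_ball_self hε, hx'Ω, hx'b⟩).ne'
    have hae : ∀ᵐ y ∂(volume.restrict G), U y < ⊤ := by
      have hres : ν.restrict G = volume.restrict G := by
        rw [Measure.restrict_restrict hG.measurableSet,
          inter_eq_left.2 (inter_subset_right.trans inter_subset_left)]
      rw [← hres]
      refine ae_lt_top' hU.restrict (ne_of_lt ((lintegral_mono_set ?_).trans_lt hx'))
      exact inter_subset_left
    have hex : ∃ x'' ∈ G, U x'' < ⊤ := by
      by_contra! hno
      refine hGpos (measure_mono_null ?_ ((ae_restrict_iff' hG.measurableSet).1 hae))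
      intro y hy
      simpa using ⟨hy, top_le_iff.1 (hno y hy)⟩
    obtain ⟨x'', ⟨-, hx''Ω, hx''b⟩, hx''⟩ := hex
    have h1 := (hle x'' hx''Ω).trans_lt hx''
    have h2 : ∫⁻ y in Metric.ball x'' r, U y ∂ν < ⊤ := by
      by_contra htop
      rw [not_lt_top_iff.1 htop, ENNReal.mul_top hκ] at h1
      exact lt_irrefl _ h1
    refine (lintegral_mono_set (Metric.ball_subset_ball' ?_)).trans_lt h2
    have := Metric.mem_ball'.1 hx''b
    linarith
  have hsub : Ω ⊆ A := hconn.subset_of_closure_inter_subset hA ⟨x₀, hx₀, ε₀, hε₀, hfin⟩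
    fun x hx => ⟨r / 2, half_pos hr, key x hx⟩
  have htb : TotallyBounded (Ω ∩ Metric.ball z R) :=
    (isCompact_closedBall z R).totallyBounded.subset
      (inter_subset_right.trans Metric.ball_subset_closedBall)
  obtain ⟨t, htΩ, htfin, hcov⟩ := Metric.finite_approx_of_totallyBounded htb (r / 2) (half_pos hr)
  have h3 : (ν.withDensity U) (⋃ y ∈ t, Metric.ball y (r / 2)) < ⊤ := by
    refine measure_biUnion_lt_top htfin fun y hy => ?_
    rw [withDensity_apply _ measurableSet_ball]
    exact key y ⟨subset_closure (hsub (htΩ hy).1), (htΩ hy).1⟩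
  have h4 : ∫⁻ y in Metric.ball z R, U y ∂ν = ∫⁻ y in Ω ∩ Metric.ball z R, U y ∂ν := by
    rw [Measure.restrict_restrict measurableSet_ball,
      Measure.restrict_restrict (hΩ.measurableSet.inter measurableSet_ball)]
    congr 2
    ext y
    simp only [mem_inter_iff]
    tauto
  rw [h4, ← withDensity_apply _ (hΩ.measurableSet.inter measurableSet_ball)]
  exact (measure_mono hcov).trans_lt h3

end

/-! ### Decay of the truncated Green function -/

/-- There is a compactly supported subsolution: a nonzero `0 ≤ φ ∈ C_c(Ω)` with
`L_Ω[φ] ≥ q b φ` in `Ω`. -/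
def HasCompactSubsolution (Ω : Set (EuclideanSpace ℝ (Fin N)))
    (K : EuclideanSpace ℝ (Fin N) → EuclideanSpace ℝ (Fin N) → ℝ) (q : ℝ)
    (b : EuclideanSpace ℝ (Fin N) → ℝ) : Prop :=
  ∃ φ : EuclideanSpace ℝ (Fin N) → ℝ, Continuous φ ∧ HasCompactSupport φ ∧
    tsupport φ ⊆ Ω ∧ (∀ x ∈ Ω, 0 ≤ φ x) ∧ (∃ x ∈ Ω, φ x ≠ 0) ∧
    ∀ x ∈ Ω, q * (b x * φ x) ≤ nonlocalOp Ω K φ x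

/-- The iterates `f, T f, T² f, …` of the operator `T g = χ · L_Ω[g] / b`. With a cut-off function
`χ ∈ C_c(Ω)` they stay in `C_c(Ω)`; with `χ = 1` their sum is the Green function of `b - L_Ω`
applied to `b · f`. -/
def greenIterate (Ω : Set (EuclideanSpace ℝ (Fin N)))
    (K : EuclideanSpace ℝ (Fin N) → EuclideanSpace ℝ (Fin N) → ℝ)
    (χ b f : EuclideanSpace ℝ (Fin N) → ℝ) : ℕ → EuclideanSpace ℝ (Fin N) → ℝ
  | 0 => f
  | k + 1 => fun x => χ x * (nonlocalOp Ω K (greenIterate Ω K χ b f k) x / b x)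

section
variable {Ω : Set (EuclideanSpace ℝ (Fin N))} {χ b f : EuclideanSpace ℝ (Fin N) → ℝ}
  {K : EuclideanSpace ℝ (Fin N) → EuclideanSpace ℝ (Fin N) → ℝ} {r₀ r₁ C₀ c₀ δ M q : ℝ}

namespace IsFiniteRangeKernel

lemma greenIterate_spec (hK : IsFiniteRangeKernel Ω K r₀ r₁ C₀ c₀)
    (hδ : 0 < δ) (hb : ContinuousOn b Ω) (hbδ : ∀ x ∈ Ω, δ ≤ b x)
    (hχ : ContinuousOn χ Ω) (hχ1 : ∀ x, χ x ∈ Icc 0 1)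
    (hf : Continuous f) (hf1 : ∀ x, f x ∈ Icc 0 1) (k : ℕ) :
    ContinuousOn (greenIterate Ω K χ b f k) Ω ∧
      ∀ x ∈ Ω, greenIterate Ω K χ b f k x ∈
        Icc 0 ((C₀ * volume.real (Metric.ball (0 : EuclideanSpace ℝ (Fin N)) r₀) / δ) ^ k) := by
  induction k with
  | zero => exact ⟨hf.continuousOn, fun x _ => by simpa [greenIterate] using hf1 x⟩
  | succ k ih =>
    obtain ⟨hc, hB⟩ := ih
    have habs : ∀ x ∈ Ω, |greenIterate Ω K χ b f k x| ≤
        (C₀ * volume.real (Metric.ball (0 : EuclideanSpace ℝ (Fin N)) r₀) / δ) ^ k := fun x hx => by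
      rw [abs_of_nonneg (hB x hx).1]; exact (hB x hx).2
    have hint := IntegrableOnBounded.of_continuousOn_bound hK.isOpen hc habs
    have hb0 : ∀ x ∈ Ω, 0 < b x := fun x hx => hδ.trans_le (hbδ x hx)
    refine ⟨hχ.mul ((hK.continuousOn_nonlocalOp hint).div hb fun x hx => (hb0 x hx).ne'),
      fun x hx => ?_⟩
    have h0 : 0 ≤ nonlocalOp Ω K (greenIterate Ω K χ b f k) x / b x :=
      div_nonneg (hK.nonlocalOp_nonneg (fun y hy => (hB y hy).1) hx) (hb0 x hx).le
    refine ⟨mul_nonneg (hχ1 x).1 h0, (mul_le_of_le_one_left h0 (hχ1 x).2).trans ?_⟩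
    have h1 := (le_abs_self _).trans (hK.abs_nonlocalOp_le habs hx)
    calc _ ≤ nonlocalOp Ω K (greenIterate Ω K χ b f k) x / δ := by
          have := hK.nonlocalOp_nonneg (fun y hy => (hB y hy).1) hx
          gcongr
          exact hbδ x hx
      _ ≤ _ := by
          rw [pow_succ, div_le_iff₀ hδ]
          refine h1.trans_eq ?_
          field_simp

lemma integrableOnBounded_greenIterate (hK : IsFiniteRangeKernel Ω K r₀ r₁ C₀ c₀)
    (hδ : 0 < δ) (hb : ContinuousOn b Ω) (hbδ : ∀ x ∈ Ω, δ ≤ b x)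
    (hχ : ContinuousOn χ Ω) (hχ1 : ∀ x, χ x ∈ Icc 0 1)
    (hf : Continuous f) (hf1 : ∀ x, f x ∈ Icc 0 1) (k : ℕ) :
    IntegrableOnBounded Ω (greenIterate Ω K χ b f k) := by
  obtain ⟨h1, h2⟩ := hK.greenIterate_spec hδ hb hbδ hχ hχ1 hf hf1 k
  exact .of_continuousOn_bound hK.isOpen h1 fun x hx =>
    (abs_of_nonneg (h2 x hx).1).trans_le (h2 x hx).2

lemma tendsto_greenIterate (hK : IsFiniteRangeKernel Ω K r₀ r₁ C₀ c₀)
    (hδ : 0 < δ) (hb : ContinuousOn b Ω) (hbδ : ∀ x ∈ Ω, δ ≤ b x)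
    {χ : ℕ → EuclideanSpace ℝ (Fin N) → ℝ}
    (hχ : ∀ n, Continuous (χ n)) (hχ1 : ∀ n x, χ n x ∈ Icc 0 1)
    (hχlim : ∀ x ∈ Ω, ∀ᶠ n in atTop, χ n x = 1)
    (hf : Continuous f) (hf1 : ∀ x, f x ∈ Icc 0 1) (k : ℕ) {x : EuclideanSpace ℝ (Fin N)}
    (hx : x ∈ Ω) :
    Tendsto (fun n => greenIterate Ω K (χ n) b f k x) atTop
      (𝓝 (greenIterate Ω K (fun _ => 1) b f k x)) := by
  induction k generalizing x with
  | zero => exact tendsto_const_nhds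
  | succ k ih =>
    have hspec := fun n => hK.greenIterate_spec hδ hb hbδ (hχ n).continuousOn (hχ1 n) hf hf1 k
    have hint := fun n =>
      hK.integrableOnBounded_greenIterate hδ hb hbδ (hχ n).continuousOn (hχ1 n) hf hf1 k
    refine Tendsto.mul (tendsto_nhds_of_eventually_eq (hχlim x hx)) (Tendsto.div_const ?_ _)
    set B := (C₀ * volume.real (Metric.ball (0 : EuclideanSpace ℝ (Fin N)) r₀) / δ) ^ k
    have hconst : IntegrableOnBounded Ω (fun _ => B) := .of_continuous hK.isOpen continuous_const
    refine tendsto_integral_of_dominated_convergence (fun y => K x y * B)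
      (fun n => (hK.integrableOn_mul (hint n) hx).1) (hK.integrableOn_mul hconst hx) ?_ ?_
    · refine fun n => (ae_restrict_iff' hK.isOpen.measurableSet).2 (.of_forall fun y hy => ?_)
      rw [Real.norm_eq_abs, abs_mul, abs_of_nonneg (hK.nonneg x hx y hy),
        abs_of_nonneg ((hspec n).2 y hy).1]
      exact mul_le_mul_of_nonneg_left ((hspec n).2 y hy).2 (hK.nonneg x hx y hy)
    · exact (ae_restrict_iff' hK.isOpen.measurableSet).2
        (.of_forall fun y hy => (ih hy).const_mul _)

/-- A truncated Green function `∑_{k ≤ m} q⁻ᵏ Tᵏ f` is a compactly supported subsolution of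
`L_Ω[φ] ≥ q b φ` as soon as its first neglected term dominates `f`. In the absence of such
subsolutions, `Tᵐ f` must be small somewhere on the set where `f` is positive. -/
lemma exists_greenIterate_lt (hK : IsFiniteRangeKernel Ω K r₀ r₁ C₀ c₀)
    (hδ : 0 < δ) (hb : ContinuousOn b Ω) (hbδ : ∀ x ∈ Ω, δ ≤ b x) (hq : 0 < q)
    (hno : ¬ HasCompactSubsolution Ω K q b)
    (hχ : Continuous χ) (hχc : IsCompact (tsupport χ)) (hχs : tsupport χ ⊆ Ω)
    (hχ1 : ∀ x, χ x ∈ Icc 0 1)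
    (hf : Continuous f) (hf1 : ∀ x, f x ∈ Icc 0 1) (hfc : IsCompact (tsupport f))
    (hfs : tsupport f ⊆ Ω) (hfne : ∃ x, f x ≠ 0) (m : ℕ) :
    ∃ x ∈ Ω, greenIterate Ω K χ b f (m + 1) x < q ^ (m + 1) * f x := by
  by_contra! hge
  refine hno ⟨fun x => ∑ k ∈ Finset.range (m + 1), q⁻¹ ^ k * greenIterate Ω K χ b f k x, ?_⟩
  have hspec := fun k => hK.greenIterate_spec hδ hb hbδ hχ.continuousOn hχ1 hf hf1 k
  have hint := fun k =>
    hK.integrableOnBounded_greenIterate hδ hb hbδ hχ.continuousOn hχ1 hf hf1 k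
  have hts : ∀ k, tsupport (greenIterate Ω K χ b f k) ⊆ tsupport f ∪ tsupport χ := by
    rintro (_ | k)
    · exact subset_union_left
    · exact (tsupport_mul_subset_left (f := χ)).trans subset_union_right
  have hQ : IsCompact (tsupport f ∪ tsupport χ) := hfc.union hχc
  have hQΩ : tsupport f ∪ tsupport χ ⊆ Ω := union_subset hfs hχs
  have hcont : ∀ k, Continuous (greenIterate Ω K χ b f k) := fun k =>
    continuous_of_tsupport fun x hx =>
      (hspec k).1.continuousAt (hK.isOpen.mem_nhds (hQΩ (hts k hx)))
  have hzero : ∀ k, ∀ x ∉ tsupport f ∪ tsupport χ, greenIterate Ω K χ b f k x = 0 := fun k x hx =>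
    image_eq_zero_of_notMem_tsupport fun h => hx (hts k h)
  have hzero' : ∀ x ∉ tsupport f ∪ tsupport χ,
      ∑ k ∈ Finset.range (m + 1), q⁻¹ ^ k * greenIterate Ω K χ b f k x = 0 := fun x hx =>
    Finset.sum_eq_zero fun k _ => by rw [hzero k x hx, mul_zero]
  have hterm : ∀ k, ∀ x ∈ Ω, 0 ≤ q⁻¹ ^ k * greenIterate Ω K χ b f k x := fun k x hx =>
    mul_nonneg (by positivity) ((hspec k).2 x hx).1
  refine ⟨continuous_finsetSum _ fun k _ => (hcont k).const_mul _,
    HasCompactSupport.intro hQ hzero', ?_, fun x hx => Finset.sum_nonneg fun k _ => hterm k x hx,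
    ?_, fun x hx => ?_⟩
  · refine (closure_minimal ?_ hQ.isClosed).trans hQΩ
    intro x hx
    by_contra hn
    exact hx (hzero' x hn)
  · obtain ⟨x, hx⟩ := hfne
    have hxΩ : x ∈ Ω := hfs (subset_tsupport f hx)
    refine ⟨x, hxΩ, ne_of_gt (lt_of_lt_of_le ?_
      (Finset.single_le_sum (fun k _ => hterm k x hxΩ) (Finset.mem_range.2 m.succ_pos)))⟩
    simpa [greenIterate] using lt_of_le_of_ne (hf1 x).1 (Ne.symm hx)
  · have hL : nonlocalOp Ω K
        (fun x => ∑ k ∈ Finset.range (m + 1), q⁻¹ ^ k * greenIterate Ω K χ b f k x) x =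
        ∑ k ∈ Finset.range (m + 1), q⁻¹ ^ k * nonlocalOp Ω K (greenIterate Ω K χ b f k) x := by
      simp only [nonlocalOp, Finset.mul_sum, ← integral_const_mul]
      rw [integral_finsetSum _ fun k _ => ?_]
      · simp only [mul_left_comm]
      · simpa only [mul_left_comm] using (hK.integrableOn_mul (hint k) hx).const_mul (q⁻¹ ^ k)
    have hbx : 0 < b x := hδ.trans_le (hbδ x hx)
    rw [hL]
    -- Each iterate is at most `L_Ω` of the previous one divided by `b`, since `χ ≤ 1`.
    have hstep : ∀ k, b x * greenIterate Ω K χ b f (k + 1) x ≤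
        nonlocalOp Ω K (greenIterate Ω K χ b f k) x := fun k => by
      have h0 := hK.nonlocalOp_nonneg (fun y hy => ((hspec k).2 y hy).1) hx
      have : b x * greenIterate Ω K χ b f (k + 1) x =
          χ x * nonlocalOp Ω K (greenIterate Ω K χ b f k) x := by
        simp only [greenIterate]
        field_simp
      rw [this]
      exact mul_le_of_le_one_left h0 (hχ1 x).2
    have hshift : ∑ k ∈ Finset.range (m + 1), q⁻¹ ^ k * greenIterate Ω K χ b f k x ≤
        ∑ k ∈ Finset.range (m + 1), q⁻¹ ^ (k + 1) * greenIterate Ω K χ b f (k + 1) x := by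
      rw [Finset.sum_range_succ', Finset.sum_range_succ]
      have := hge x hx
      have h1 : f x ≤ q⁻¹ ^ (m + 1) * greenIterate Ω K χ b f (m + 1) x := by
        rw [inv_pow, ← div_eq_inv_mul, le_div_iff₀ (by positivity), mul_comm]
        exact this
      simpa [greenIterate] using h1
    calc _ ≤ q * (b x * ∑ k ∈ Finset.range (m + 1),
            q⁻¹ ^ (k + 1) * greenIterate Ω K χ b f (k + 1) x) := by gcongr
      _ = ∑ k ∈ Finset.range (m + 1), q⁻¹ ^ k * (b x * greenIterate Ω K χ b f (k + 1) x) := by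
          simp only [Finset.mul_sum]
          refine Finset.sum_congr rfl fun k _ => ?_
          rw [pow_succ]
          field_simp
      _ ≤ _ := Finset.sum_le_sum fun k _ => by
          have := hstep k
          gcongr

/-- Geometric decay of the iterates, measured on the support of `f`. The constant does not depend
on the cut-off functions, which is why the bound survives their removal. -/
lemma setIntegral_greenIterate_le (hK : IsFiniteRangeKernel Ω K r₀ r₁ C₀ c₀)
    (hδ : 0 < δ) (hb : ContinuousOn b Ω) (hbδ : ∀ x ∈ Ω, δ ≤ b x) (hbM : ∀ x ∈ Ω, b x ≤ M)
    (hq : 0 < q)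
    (hno : ¬ HasCompactSubsolution Ω K q b)
    (hf : Continuous f) (hf1 : ∀ x, f x ∈ Icc 0 1) (hfc : IsCompact (tsupport f))
    (hfs : tsupport f ⊆ Ω) (hfne : ∃ x, f x ≠ 0)
    (hfd : ∀ x ∈ tsupport f, tsupport f ⊆ Metric.ball x r₁) (m : ℕ) :
    ∫ y in tsupport f, greenIterate Ω K (fun _ => 1) b f m y ≤ M / c₀ * q ^ (m + 1) := by
  obtain ⟨χ, hχ⟩ := exists_cutoff_sequence hK.isOpen hfc hfs
  have hχ1 : ∀ n x, χ n x ∈ Icc 0 1 := fun n => (hχ n).1.2.2.2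
  have hχc : ∀ n, Continuous (χ n) := fun n => (hχ n).1.1
  have hspec := fun n => hK.greenIterate_spec hδ hb hbδ (hχc n).continuousOn (hχ1 n) hf hf1 m
  have hint := fun n =>
    hK.integrableOnBounded_greenIterate hδ hb hbδ (hχc n).continuousOn (hχ1 n) hf hf1 m
  have hQm : MeasurableSet (tsupport f) := hfc.measurableSet
  refine le_of_tendsto (f := fun n => ∫ y in tsupport f, greenIterate Ω K (χ n) b f m y)
    (x := atTop) ?_ (.of_forall fun n => ?_)
  · set B := (C₀ * volume.real (Metric.ball (0 : EuclideanSpace ℝ (Fin N)) r₀) / δ) ^ m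
    refine tendsto_integral_of_dominated_convergence (fun _ => B)
      (fun n => (hint n).aestronglyMeasurable.mono_set hfs)
      (integrableOn_const hfc.measure_lt_top.ne) ?_ ?_
    · refine fun n => (ae_restrict_iff' hQm).2 (.of_forall fun y hy => ?_)
      rw [Real.norm_eq_abs, abs_of_nonneg ((hspec n).2 y (hfs hy)).1]
      exact ((hspec n).2 y (hfs hy)).2
    · exact (ae_restrict_iff' hQm).2 (.of_forall fun y hy =>
        hK.tendsto_greenIterate hδ hb hbδ hχc hχ1 (hχ 0).2.2 hf hf1 m (hfs hy))
  · obtain ⟨x, hxΩ, hx⟩ := hK.exists_greenIterate_lt hδ hb hbδ hq hno (hχc n) (hχ n).1.2.1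
      (hχ n).1.2.2.1 (hχ1 n) hf hf1 hfc hfs hfne m
    have hspec' := (hK.greenIterate_spec hδ hb hbδ (hχc n).continuousOn (hχ1 n) hf hf1 (m + 1)).2
      x hxΩ
    have hfx : f x ≠ 0 := by
      rintro h0
      rw [h0, mul_zero] at hx
      exact absurd hspec'.1 (not_le.2 hx)
    have hxQ : x ∈ tsupport f := subset_tsupport f hfx
    have hbx : 0 < b x := hδ.trans_le (hbδ x hxΩ)
    have h1 : nonlocalOp Ω K (greenIterate Ω K (χ n) b f m) x / b x < q ^ (m + 1) := by
      have : greenIterate Ω K (χ n) b f (m + 1) x =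
          nonlocalOp Ω K (greenIterate Ω K (χ n) b f m) x / b x := by
        simp only [greenIterate, (hχ n).2.1 x hxQ, one_mul]
      rw [← this]
      exact hx.trans_le (mul_le_of_le_one_right (by positivity) (hf1 x).2)
    have h2 := hK.mul_setIntegral_le_nonlocalOp (hint n) (fun y hy => ((hspec n).2 y hy).1) hxΩ hQm
      hfs (hfd x hxQ)
    have h3 : nonlocalOp Ω K (greenIterate Ω K (χ n) b f m) x ≤ M * q ^ (m + 1) := by
      rw [div_lt_iff₀ hbx, mul_comm] at h1
      exact h1.le.trans (mul_le_mul_of_nonneg_right (hbM x hxΩ) (by positivity))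
    rw [div_mul_eq_mul_div, le_div_iff₀ hK.c₀_pos, mul_comm]
    exact h2.trans h3

end IsFiniteRangeKernel
end

/-! ### The Green function and the inequalities `λ_p' ≤ λ_p'' ≤ λ_p` -/

section
variable {Ω : Set (EuclideanSpace ℝ (Fin N))} {b f u : EuclideanSpace ℝ (Fin N) → ℝ}
  {K : EuclideanSpace ℝ (Fin N) → EuclideanSpace ℝ (Fin N) → ℝ} {r₀ r₁ C₀ c₀ δ M q : ℝ}

namespace IsFiniteRangeKernel

lemma ofReal_nonlocalOp (hK : IsFiniteRangeKernel Ω K r₀ r₁ C₀ c₀) (hu : IntegrableOnBounded Ω u)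
    (hu0 : ∀ x ∈ Ω, 0 ≤ u x) {x : EuclideanSpace ℝ (Fin N)} (hx : x ∈ Ω) :
    ENNReal.ofReal (nonlocalOp Ω K u x) =
      ∫⁻ y in Ω, ENNReal.ofReal (K x y) * ENNReal.ofReal (u y) := by
  rw [nonlocalOp, ofReal_integral_eq_lintegral_ofReal (hK.integrableOn_mul hu hx)
    ((ae_restrict_iff' hK.isOpen.measurableSet).2 (.of_forall fun y hy =>
      mul_nonneg (hK.nonneg x hx y hy) (hu0 y hy)))]
  refine setLIntegral_congr_fun hK.isOpen.measurableSet fun y hy => ?_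
  exact ENNReal.ofReal_mul (hK.nonneg x hx y hy)

/-- The Green function: in the absence of compactly supported subsolutions for some `q < 1`, the
Neumann series `∑ Tᵏ f` converges to a solution of `u = f + L_Ω[u] / b`. Decay on the support of `f`
gives local integrability there, and the lower bound on the kernel propagates it to all of `Ω`. -/
lemma exists_green_function (hK : IsFiniteRangeKernel Ω K r₀ r₁ C₀ c₀) (hconn : IsPreconnected Ω)
    (hδ : 0 < δ) (hb : ContinuousOn b Ω) (hbδ : ∀ x ∈ Ω, δ ≤ b x) (hbM : ∀ x ∈ Ω, b x ≤ M)
    (hq : 0 < q) (hq1 : q < 1)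
    (hno : ¬ HasCompactSubsolution Ω K q b)
    (hf : Continuous f) (hf1 : ∀ x, f x ∈ Icc 0 1) (hfc : IsCompact (tsupport f))
    (hfs : tsupport f ⊆ Ω) (hfne : ∃ x, f x ≠ 0)
    (hfd : ∀ x ∈ tsupport f, tsupport f ⊆ Metric.ball x r₁) :
    ∃ u : EuclideanSpace ℝ (Fin N) → ℝ, IntegrableOnBounded Ω u ∧ (∀ x ∈ Ω, 0 ≤ u x) ∧
      ∀ x ∈ Ω, u x = f x + nonlocalOp Ω K u x / b x := by
  have hΩm : MeasurableSet Ω := hK.isOpen.measurableSet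
  set v := greenIterate Ω K (fun _ => 1) b f with hv
  have h11 : ∀ _ : EuclideanSpace ℝ (Fin N), (1 : ℝ) ∈ Icc (0 : ℝ) 1 := fun _ => by simp
  have hspec := fun k => hK.greenIterate_spec hδ hb hbδ continuousOn_const h11 hf hf1 k
  have hv0 : ∀ k, ∀ x ∈ Ω, 0 ≤ v k x := fun k x hx => ((hspec k).2 x hx).1
  have hint : ∀ k, IntegrableOnBounded Ω (v k) := fun k =>
    hK.integrableOnBounded_greenIterate hδ hb hbδ continuousOn_const h11 hf hf1 k
  have hb0 : ∀ x ∈ Ω, 0 < b x := fun x hx => hδ.trans_le (hbδ x hx)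
  set ν := (volume.restrict Ω : Measure (EuclideanSpace ℝ (Fin N)))
  let U : EuclideanSpace ℝ (Fin N) → ENNReal := fun x => ∑' k, ENNReal.ofReal (v k x)
  have hvm : ∀ k, AEMeasurable (fun x => ENNReal.ofReal (v k x)) ν := fun k =>
    (hint k).aestronglyMeasurable.aemeasurable.ennreal_ofReal
  have hUm : AEMeasurable U ν := AEMeasurable.tsum hvm
  have hUeq : ∀ x ∈ Ω, U x = ENNReal.ofReal (f x) +
      ENNReal.ofReal (b x)⁻¹ * ∫⁻ y, ENNReal.ofReal (K x y) * U y ∂ν := fun x hx => by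
    have hk : ∀ k, ENNReal.ofReal (v (k + 1) x) = ENNReal.ofReal (b x)⁻¹ *
        ∫⁻ y, ENNReal.ofReal (K x y) * ENNReal.ofReal (v k y) ∂ν := fun k => by
      rw [← hK.ofReal_nonlocalOp (hint k) (hv0 k) hx, ← ENNReal.ofReal_mul (by
        have := hb0 x hx; positivity)]
      congr 1
      simp only [hv, greenIterate]
      ring
    simp only [U]
    rw [tsum_eq_zero_add' ENNReal.summable]
    simp only [hk, ENNReal.tsum_mul_left]
    rw [← lintegral_tsum (f := fun k y => ENNReal.ofReal (K x y) * ENNReal.ofReal (v k y))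
      fun k => (hK.aemeasurable x hx).ennreal_ofReal.mul (hvm k)]
    simp only [ENNReal.tsum_mul_left, hv, greenIterate]
    rfl
  obtain ⟨x₀, hx₀⟩ := hfne
  have hx₀Q : x₀ ∈ tsupport f := subset_tsupport f hx₀
  have hM : 0 < M := (hb0 x₀ (hfs hx₀Q)).trans_le (hbM x₀ (hfs hx₀Q))
  have hUle : ∀ x ∈ Ω, ENNReal.ofReal (c₀ / M) * ∫⁻ y in Metric.ball x r₁, U y ∂ν ≤ U x := by
    intro x hx
    refine le_trans ?_ ((le_add_left le_rfl).trans_eq (hUeq x hx).symm)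
    rw [div_eq_inv_mul, ENNReal.ofReal_mul (by positivity), mul_assoc]
    refine mul_le_mul' (ENNReal.ofReal_le_ofReal ?_) ?_
    · exact inv_anti₀ (hb0 x hx) (hbM x hx)
    · rw [← lintegral_const_mul'' _ hUm.restrict, ← lintegral_indicator measurableSet_ball]
      refine lintegral_mono_ae ((ae_restrict_iff' hΩm).2 (.of_forall fun y hy => ?_))
      by_cases hyx : y ∈ Metric.ball x r₁
      · rw [indicator_of_mem hyx]
        exact mul_le_mul_left (ENNReal.ofReal_le_ofReal (hK.ge x hx y hy hyx)) _
      · rw [indicator_of_notMem hyx]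
        exact zero_le
  have hQν : ν.restrict (tsupport f) = volume.restrict (tsupport f) := by
    rw [Measure.restrict_restrict hfc.measurableSet, inter_eq_left.2 hfs]
  have hQfin : ∫⁻ y in tsupport f, U y ∂ν < ⊤ := by
    rw [lintegral_tsum fun k => (hvm k).restrict]
    have hgeom : Summable fun k : ℕ => M / c₀ * q ^ (k + 1) :=
      ((summable_nat_add_iff 1).2 (summable_geometric_of_lt_one hq.le hq1)).mul_left _
    refine (ENNReal.tsum_le_tsum fun k => ?_).trans_lt hgeom.tsum_ofReal_lt_top
    rw [hQν, ← ofReal_integral_eq_lintegral_ofReal]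
    · exact ENNReal.ofReal_le_ofReal
        (hK.setIntegral_greenIterate_le hδ hb hbδ hbM hq hno hf hf1 hfc hfs ⟨x₀, hx₀⟩ hfd k)
    · exact ((hint k).integrableOn x₀ r₁).mono_set (subset_inter hfs (hfd x₀ hx₀Q))
    · exact (ae_restrict_iff' hfc.measurableSet).2 (.of_forall fun y hy => hv0 k y (hfs hy))
  obtain ⟨ε, hε, hεs⟩ := Metric.isOpen_iff.1 hf.isOpen_support x₀ hx₀
  have hUfin : ∀ z R, ∫⁻ y in Metric.ball z R, U y ∂ν < ⊤ :=
    lintegral_ball_lt_top_of_le hK.isOpen hconn hUm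
      (ENNReal.ofReal_pos.2 (div_pos hK.c₀_pos hM)).ne' hK.r₁_pos hUle (hfs hx₀Q) hε
      ((lintegral_mono_set (hεs.trans (subset_tsupport f))).trans_lt hQfin)
  have hKU : ∀ x ∈ Ω, ∫⁻ y, ENNReal.ofReal (K x y) * U y ∂ν < ⊤ := by
    intro x hx
    have hle : ∫⁻ y, ENNReal.ofReal (K x y) * U y ∂ν ≤
        ENNReal.ofReal C₀ * ∫⁻ y in Metric.ball x r₀, U y ∂ν := by
      rw [← lintegral_const_mul'' _ hUm.restrict, ← lintegral_indicator measurableSet_ball]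
      refine lintegral_mono_ae ((ae_restrict_iff' hΩm).2 (.of_forall fun y hy => ?_))
      by_cases hyx : y ∈ Metric.ball x r₀
      · rw [indicator_of_mem hyx]
        exact mul_le_mul_left (ENNReal.ofReal_le_ofReal (hK.le x hx y hy)) _
      · rw [hK.eq_zero x hx y hy (by simpa using hyx)]
        simp
    exact hle.trans_lt (ENNReal.mul_lt_top ENNReal.ofReal_lt_top (hUfin x r₀))
  have hUlt : ∀ x ∈ Ω, U x < ⊤ := fun x hx => by
    rw [hUeq x hx]
    exact ENNReal.add_lt_top.2 ⟨ENNReal.ofReal_lt_top,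
      ENNReal.mul_lt_top ENNReal.ofReal_lt_top (hKU x hx)⟩
  have hu : IntegrableOnBounded Ω (fun x => (U x).toReal) := by
    refine ⟨hUm.ennreal_toReal.aestronglyMeasurable, fun z R => ?_⟩
    rw [IntegrableOn, inter_comm, ← Measure.restrict_restrict measurableSet_ball]
    exact integrable_toReal_of_lintegral_ne_top hUm.restrict (hUfin z R).ne
  refine ⟨fun x => (U x).toReal, hu, fun x _ => ENNReal.toReal_nonneg, fun x hx => ?_⟩
  have hL : ENNReal.ofReal (nonlocalOp Ω K (fun x => (U x).toReal) x) =
      ∫⁻ y, ENNReal.ofReal (K x y) * U y ∂ν := by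
    rw [hK.ofReal_nonlocalOp hu (fun x _ => ENNReal.toReal_nonneg) hx]
    refine setLIntegral_congr_fun hΩm fun y hy => ?_
    simp only [ENNReal.ofReal_toReal (hUlt y hy).ne]
  have hL0 := hK.nonlocalOp_nonneg (g := fun x => (U x).toReal)
    (fun x _ => ENNReal.toReal_nonneg) hx
  have hbi : 0 ≤ (b x)⁻¹ := inv_nonneg.2 (hb0 x hx).le
  have h1 := hUeq x hx
  rw [← hL, ← ENNReal.ofReal_mul hbi, ← ENNReal.ofReal_add (hf1 x).1 (mul_nonneg hbi hL0)] at h1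
  simp only [h1]
  rw [ENNReal.toReal_ofReal (add_nonneg (hf1 x).1 (mul_nonneg hbi hL0)), inv_mul_eq_div]

/-- A strong maximum principle: a nonnegative `u` with `L_Ω[u] ≤ b u` that is positive somewhere is
positive everywhere, with a uniform lower bound near every point of the closure. -/
lemma exists_pos_le_of_nonlocalOp_le (hK : IsFiniteRangeKernel Ω K r₀ r₁ C₀ c₀)
    (hconn : IsPreconnected Ω) (hM : 0 < M) (hbM : ∀ x ∈ Ω, b x ≤ M)
    (hu : IntegrableOnBounded Ω u) (huc : ContinuousOn u Ω) (hu0 : ∀ x ∈ Ω, 0 ≤ u x)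
    (hle : ∀ x ∈ Ω, nonlocalOp Ω K u x ≤ b x * u x) (hne : ∃ x ∈ Ω, u x ≠ 0)
    {z : EuclideanSpace ℝ (Fin N)} (hz : z ∈ closure Ω) :
    ∃ ε > 0, ∀ᶠ x in 𝓝[Ω] z, ε ≤ u x := by
  have hP : IsOpen (Ω ∩ u ⁻¹' Ioi 0) := huc.isOpen_inter_preimage hK.isOpen isOpen_Ioi
  have hlow : ∀ x ∈ Ω, ∀ s, MeasurableSet s → s ⊆ Ω → s ⊆ Metric.ball x r₁ →
      c₀ * (∫ y in s, u y) / M ≤ u x := fun x hx s hs hsΩ hsx => by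
    rw [div_le_iff₀ hM, mul_comm (u x)]
    exact (hK.mul_setIntegral_le_nonlocalOp hu hu0 hx hs hsΩ hsx).trans
      ((hle x hx).trans (mul_le_mul_of_nonneg_right (hbM x hx) (hu0 x hx)))
  have hint : ∀ w R, ((Ω ∩ u ⁻¹' Ioi 0) ∩ Metric.ball w R).Nonempty →
      0 < ∫ y in (Ω ∩ u ⁻¹' Ioi 0) ∩ Metric.ball w R, u y := fun w R hwR => by
    have hop := hP.inter (Metric.isOpen_ball (x := w) (ε := R))
    rw [setIntegral_pos_iff_support_of_nonneg_ae]
    · have hsupp : (Ω ∩ u ⁻¹' Ioi 0) ∩ Metric.ball w R ⊆ Function.support u :=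
        fun y hy => ne_of_gt (mem_Ioi.1 hy.1.2)
      rw [inter_eq_right.2 hsupp]
      exact hop.measure_pos volume hwR
    · exact (ae_restrict_iff' hop.measurableSet).2 (.of_forall fun y hy => hu0 y hy.1.1)
    · exact (hu.integrableOn w R).mono_set (inter_subset_inter_left _ inter_subset_left)
  have hsub : Ω ⊆ Ω ∩ u ⁻¹' Ioi 0 := by
    refine hconn.subset_of_closure_inter_subset hP ?_ fun x hx => ⟨hx.2, ?_⟩
    · obtain ⟨x, hx, hux⟩ := hne
      exact ⟨x, hx, hx, lt_of_le_of_ne (hu0 x hx) (Ne.symm hux)⟩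
    · obtain ⟨y, hyb, hy⟩ := mem_closure_iff.1 hx.1 (Metric.ball x r₁) Metric.isOpen_ball
        (Metric.mem_ball_self hK.r₁_pos)
      have h1 := hint x r₁ ⟨y, hy, hyb⟩
      refine lt_of_lt_of_le ?_ (hlow x hx.2 _ (hP.inter Metric.isOpen_ball).measurableSet
        (inter_subset_left.trans inter_subset_left) inter_subset_right)
      exact div_pos (mul_pos hK.c₀_pos h1) hM
  have hr := half_pos hK.r₁_pos
  obtain ⟨y, hyb, hy⟩ := mem_closure_iff.1 hz (Metric.ball z (r₁ / 2)) Metric.isOpen_ball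
    (Metric.mem_ball_self hr)
  refine ⟨c₀ * (∫ y in (Ω ∩ u ⁻¹' Ioi 0) ∩ Metric.ball z (r₁ / 2), u y) / M,
    div_pos (mul_pos hK.c₀_pos (hint z _ ⟨y, hsub hy, hyb⟩)) hM, ?_⟩
  filter_upwards [eventually_mem_nhdsWithin,
    eventually_nhdsWithin_of_eventually_nhds (Metric.ball_mem_nhds z hr)] with x hx hxz
  refine hlow x hx _ (hP.inter Metric.isOpen_ball).measurableSet
    (inter_subset_left.trans inter_subset_left) (inter_subset_right.trans ?_)
  refine Metric.ball_subset_ball' ?_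
  have := Metric.mem_ball'.1 hxz
  linarith

/-- The duality behind `λ_p'' ≤ λ_p`: either there is a compactly supported subsolution
`L_Ω[φ] ≥ q b φ`, or there is a positive supersolution `L_Ω[φ] ≤ b φ`, continuous up to the
boundary. -/
lemma exists_supersolution (hK : IsFiniteRangeKernel Ω K r₀ r₁ C₀ c₀) (hconn : IsConnected Ω)
    (hδ : 0 < δ) (hb : ContinuousOn b (closure Ω)) (hbδ : ∀ x ∈ Ω, δ ≤ b x)
    (hbM : ∀ x ∈ Ω, b x ≤ M) (hq : 0 < q) (hq1 : q < 1)
    (hno : ¬ HasCompactSubsolution Ω K q b) :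
    ∃ φ : EuclideanSpace ℝ (Fin N) → ℝ, ContinuousOn φ (closure Ω) ∧ (∀ x ∈ closure Ω, 0 < φ x) ∧
      ∀ x ∈ Ω, nonlocalOp Ω K φ x ≤ b x * φ x := by
  have hΩm : MeasurableSet Ω := hK.isOpen.measurableSet
  have hb0 : ∀ x ∈ Ω, 0 < b x := fun x hx => hδ.trans_le (hbδ x hx)
  obtain ⟨x₀, hx₀⟩ := hconn.nonempty
  have hM : 0 < M := (hb0 x₀ hx₀).trans_le (hbM x₀ hx₀)
  -- The source term: a bump whose support has diameter less than `r₁`.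
  obtain ⟨f, hf1, hfc, hfs, hf01⟩ := exists_continuousMap_one_of_isCompact_subset_isOpen
    (isCompact_singleton (x := x₀))
    (hK.isOpen.inter (Metric.isOpen_ball (x := x₀) (ε := r₁ / 2)))
    (singleton_subset_iff.2 ⟨hx₀, Metric.mem_ball_self (half_pos hK.r₁_pos)⟩)
  have hfx₀ : f x₀ = 1 := hf1 rfl
  have hfd : ∀ x ∈ tsupport f, tsupport f ⊆ Metric.ball x r₁ := fun x hx y hy => by
    have h1 := Metric.mem_ball.1 (hfs hx).2
    have h2 := Metric.mem_ball.1 (hfs hy).2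
    have h3 := dist_triangle_right y x x₀
    exact Metric.mem_ball.2 (by linarith)
  obtain ⟨u, hu, hu0, hueq⟩ := hK.exists_green_function hconn.isPreconnected hδ
    (hb.mono subset_closure) hbδ hbM hq hq1 hno f.continuous hf01 hfc
    (hfs.trans inter_subset_left) ⟨x₀, by simp [hfx₀]⟩ hfd
  have hle : ∀ x ∈ Ω, nonlocalOp Ω K u x ≤ b x * u x := fun x hx => by
    have h1 := mul_nonneg (hb0 x hx).le (hf01 x).1
    rw [hueq x hx, mul_add, mul_div_cancel₀ _ (hb0 x hx).ne']
    linarith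
  have huc : ContinuousOn u Ω :=
    (f.continuous.continuousOn.add ((hK.continuousOn_nonlocalOp hu).div (hb.mono subset_closure)
      fun x hx => (hb0 x hx).ne')).congr hueq
  have hne : ∃ x ∈ Ω, u x ≠ 0 := by
    refine ⟨x₀, hx₀, ne_of_gt ?_⟩
    rw [hueq x₀ hx₀, hfx₀]
    exact add_pos_of_pos_of_nonneg one_pos
      (div_nonneg (hK.nonlocalOp_nonneg hu0 hx₀) (hb0 x₀ hx₀).le)
  have hlim : ∀ z ∈ closure Ω, ∃ l, Tendsto u (𝓝[Ω] z) (𝓝 l) := fun z hz => by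
    have hnb : (𝓝[Ω] z).NeBot := mem_closure_iff_nhdsWithin_neBot.1 hz
    have hbz : Tendsto b (𝓝[Ω] z) (𝓝 (b z)) :=
      (hb z hz).mono_left (nhdsWithin_mono z subset_closure)
    have hbz0 : δ ≤ b z := ge_of_tendsto hbz
      (eventually_mem_nhdsWithin.mono fun x hx => hbδ x hx)
    obtain ⟨l, hl⟩ := hK.exists_tendsto_nonlocalOp hu hz
    refine ⟨f z + l / b z, Tendsto.congr' ?_ ((f.continuous.tendsto z |>.mono_left
      nhdsWithin_le_nhds).add (hl.div hbz (hδ.trans_le hbz0).ne'))⟩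
    filter_upwards [eventually_mem_nhdsWithin] with x hx using (hueq x hx).symm
  have hext : ∀ x ∈ Ω, extendFrom Ω u x = u x := fun x hx =>
    extendFrom_eq (subset_closure hx) (huc x hx)
  refine ⟨extendFrom Ω u, continuousOn_extendFrom le_rfl hlim, fun z hz => ?_, fun x hx => ?_⟩
  · have hnb : (𝓝[Ω] z).NeBot := mem_closure_iff_nhdsWithin_neBot.1 hz
    obtain ⟨ε, hε, hev⟩ := hK.exists_pos_le_of_nonlocalOp_le hconn.isPreconnected hM hbM hu huc hu0
      hle hne hz
    exact hε.trans_le (ge_of_tendsto (tendsto_extendFrom (hlim z hz)) hev)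
  · have hL : nonlocalOp Ω K (extendFrom Ω u) x = nonlocalOp Ω K u x :=
      setIntegral_congr_fun hΩm fun y hy => by simp only [hext y hy]
    rw [hL, hext x hx]
    exact hle x hx

/-- With `b = -(a + l)`, the absence of compactly supported subsolutions for some `l' > l` is the
absence of subsolutions for `b` and a suitable `q < 1`. -/
lemma lambdaPSecond_le_lambdaP (hK : IsFiniteRangeKernel Ω K r₀ r₁ C₀ c₀) (hconn : IsConnected Ω)
    {a : EuclideanSpace ℝ (Fin N) → ℝ} (ha : IsAdmissiblePotential Ω a) :
    lambdaPSecond Ω K a ≤ lambdaP Ω K a := by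
  obtain ⟨hac, A, hA⟩ := ha
  refine EReal.ge_of_forall_gt_iff_ge.1 fun l hl => ?_
  obtain ⟨l', hll', hl'⟩ := EReal.lt_iff_exists_real_btwn.1 hl
  have hlt : l < l' := EReal.coe_lt_coe_iff.1 hll'
  have hno : ¬ ∃ φ : EuclideanSpace ℝ (Fin N) → ℝ,
      Continuous φ ∧ HasCompactSupport φ ∧ tsupport φ ⊆ Ω ∧
      (∀ x ∈ Ω, 0 ≤ φ x) ∧ (∃ x ∈ Ω, φ x ≠ 0) ∧
      ∀ x ∈ Ω, 0 ≤ nonlocalOp Ω K φ x + (a x + l') * φ x := fun h =>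
    absurd hl' (not_lt.2 (sInf_le (mem_image_of_mem (fun μ : ℝ => (μ : EReal)) h)))
  -- Where `a + l' > 0`, any bump would be a subsolution.
  have hal : ∀ x ∈ Ω, a x + l' ≤ 0 := by
    by_contra! ⟨x₀, hx₀, hpos⟩
    have hop : IsOpen (Ω ∩ a ⁻¹' Ioi (-l')) :=
      (hac.mono subset_closure).isOpen_inter_preimage hK.isOpen isOpen_Ioi
    obtain ⟨f, hf1, hfc, hfs, hf01⟩ := exists_continuousMap_one_of_isCompact_subset_isOpen
      (isCompact_singleton (x := x₀)) hop
      (singleton_subset_iff.2 ⟨hx₀, by simp only [mem_preimage, mem_Ioi]; linarith⟩)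
    refine hno ⟨f, f.continuous, hfc, hfs.trans inter_subset_left, fun x _ => (hf01 x).1,
      ⟨x₀, hx₀, by simp [hf1 (mem_singleton x₀)]⟩, fun x hx => ?_⟩
    refine add_nonneg (hK.nonlocalOp_nonneg (fun y _ => (hf01 y).1) hx) ?_
    by_cases hfx : x ∈ tsupport f
    · have : -l' < a x := (hfs hfx).2
      exact mul_nonneg (by linarith) (hf01 x).1
    · simp [image_eq_zero_of_notMem_tsupport hfx]
  set δ := l' - l with hδd
  have hδ : 0 < δ := sub_pos.2 hlt
  set M := A + |l| + δ + δ with hMd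
  have hbM : ∀ x ∈ Ω, -(a x + l) ≤ M - δ := fun x hx => by
    have h1 := neg_abs_le (a x)
    have h2 := hA x hx
    have h3 := neg_abs_le l
    linarith
  have hbδ : ∀ x ∈ Ω, δ ≤ -(a x + l) := fun x hx => by
    have := hal x hx
    linarith
  obtain ⟨x₀, hx₀⟩ := hconn.nonempty
  have hMδ : δ < M := by
    have h1 := hbM x₀ hx₀
    have h2 := hbδ x₀ hx₀
    linarith
  have hM : 0 < M := hδ.trans hMδ
  obtain ⟨φ, hφc, hφ0, hφ⟩ := hK.exists_supersolution (b := fun x => -(a x + l)) (M := M)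
    (q := 1 - δ / M) hconn hδ (hac.add continuousOn_const).neg hbδ
    (fun x hx => by have := hbM x hx; linarith)
    (sub_pos.2 ((div_lt_one hM).2 hMδ)) (by have := div_pos hδ hM; linarith) <| by
      rintro ⟨φ, h1, h2, h3, h4, h5, h6⟩
      refine hno ⟨φ, h1, h2, h3, h4, h5, fun x hx => ?_⟩
      have h7 := h6 x hx
      -- `q b ≤ b - δ`, because `b ≤ M`.
      have h8 : δ / M * -(a x + l) ≤ δ := by
        rw [div_mul_eq_mul_div, div_le_iff₀ hM]
        have := hbM x hx
        exact mul_le_mul_of_nonneg_left (by linarith) hδ.le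
      have h9 := mul_le_mul_of_nonneg_right h8 (h4 x hx)
      have h10 : (a x + l') * φ x = -(-(a x + l) * φ x) + δ * φ x := by rw [hδd]; ring
      rw [h10]
      nlinarith
  refine le_sSup ⟨l, ⟨φ, hφc, hφ0, fun x hx => ?_⟩, rfl⟩
  have := hφ x hx
  linarith

end IsFiniteRangeKernel

lemma lambdaPPrime_le_lambdaPSecond (K : EuclideanSpace ℝ (Fin N) → EuclideanSpace ℝ (Fin N) → ℝ)
    (a : EuclideanSpace ℝ (Fin N) → ℝ) : lambdaPPrime Ω K a ≤ lambdaPSecond Ω K a := by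
  refine sInf_le_sInf (image_mono ?_)
  rintro l ⟨φ, h1, h2, -, h4⟩
  obtain ⟨B, hB⟩ := h1.bounded_above_of_compact_support h2
  exact ⟨φ, h1.continuousOn, ⟨B, fun x _ => hB x⟩, h4⟩

end

/-! ### Weighted subsolutions and `λ_v ≤ λ_p'` -/

section
variable {Ω : Set (EuclideanSpace ℝ (Fin N))} {a : EuclideanSpace ℝ (Fin N) → ℝ}
  {K : EuclideanSpace ℝ (Fin N) → EuclideanSpace ℝ (Fin N) → ℝ} {r₀ r₁ C₀ c₀ : ℝ}

lemma integral_sq_pos {ψ : EuclideanSpace ℝ (Fin N) → ℝ} (hψ : MemLp ψ 2 (volume.restrict Ω))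
    (hne : ¬ ψ =ᵐ[volume.restrict Ω] 0) : 0 < ∫ x in Ω, ψ x ^ 2 := by
  refine lt_of_le_of_ne (integral_nonneg fun x => sq_nonneg _) fun h => hne ?_
  filter_upwards [(integral_eq_zero_iff_of_nonneg (fun x => sq_nonneg (ψ x)) hψ.integrable_sq).1
    h.symm] with x hx
  simpa using hx

/-- The weight `x ↦ (1 + η ‖x‖)^{-(N + 1)}`, integrable over `ℝᴺ` and nearly constant at unit scale
when `η` is small. -/
def decayWeight (η : ℝ) (x : EuclideanSpace ℝ (Fin N)) : ℝ := ((1 + η * ‖x‖) ^ (N + 1))⁻¹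

lemma decayWeight_pos {η : ℝ} (hη : 0 < η) (x : EuclideanSpace ℝ (Fin N)) :
    0 < decayWeight η x := by
  unfold decayWeight
  positivity

lemma decayWeight_le_one {η : ℝ} (hη : 0 < η) (x : EuclideanSpace ℝ (Fin N)) :
    decayWeight η x ≤ 1 :=
  inv_le_one_of_one_le₀ (one_le_pow₀ (le_add_of_nonneg_right (by positivity)))

lemma continuous_decayWeight {η : ℝ} (hη : 0 < η) :
    Continuous (decayWeight η : EuclideanSpace ℝ (Fin N) → ℝ) := by
  unfold decayWeight
  refine Continuous.inv₀ (by fun_prop) fun x => ?_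
  positivity

lemma integrable_decayWeight {η : ℝ} (hη : 0 < η) :
    Integrable (decayWeight η : EuclideanSpace ℝ (Fin N) → ℝ) := by
  have h1 : Integrable (fun x : EuclideanSpace ℝ (Fin N) => (1 + ‖x‖) ^ (-((N + 1 : ℕ) : ℝ))) :=
    integrable_one_add_norm (by simp)
  refine (h1.comp_smul hη.ne').congr (.of_forall fun x => ?_)
  simp only [decayWeight]
  rw [norm_smul, Real.norm_of_nonneg hη.le, Real.rpow_neg (by positivity), Real.rpow_natCast]

lemma mul_decayWeight_le {η r : ℝ} (hη : 0 < η) (hr : 0 < r) {x y : EuclideanSpace ℝ (Fin N)}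
    (hxy : dist y x < r) :
    ((1 + η * r) ^ (N + 1))⁻¹ * decayWeight η x ≤ decayWeight η y := by
  unfold decayWeight
  rw [← mul_inv, ← mul_pow]
  refine inv_anti₀ (by positivity) (pow_le_pow_left₀ (by positivity) ?_ _)
  have h1 : ‖y‖ ≤ r + ‖x‖ := by
    have := norm_le_norm_add_norm_sub' y x
    rw [← dist_eq_norm] at this
    linarith
  have h2 := mul_le_mul_of_nonneg_left h1 hη.le
  have h3 : 0 ≤ η * r * (η * ‖x‖) := by positivity
  nlinarith

namespace IsFiniteRangeKernel

/-- A bounded subsolution multiplied by a slowly decaying weight is an admissible function for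
`λ_v`, and at a small cost in the eigenvalue still a subsolution. -/
lemma lambdaV_le_lambdaPPrime (hK : IsFiniteRangeKernel Ω K r₀ r₁ C₀ c₀)
    (ha : IsAdmissiblePotential Ω a) : lambdaV Ω K a ≤ lambdaPPrime Ω K a := by
  obtain ⟨hac, A, hA⟩ := ha
  have hΩm : MeasurableSet Ω := hK.isOpen.measurableSet
  refine le_sInf ?_
  rintro _ ⟨l, ⟨φ, hφc, ⟨B, hB⟩, hφ0, ⟨x₀, hx₀, hφx₀⟩, hφ⟩, rfl⟩
  refine EReal.le_of_forall_lt_iff_le.1 fun z hz => ?_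
  have hlz : l < z := EReal.coe_lt_coe_iff.1 hz
  have hr := hK.r₀_pos
  have hη : ∃ η : ℝ, 0 < η ∧ (1 - ((1 + η * r₀) ^ (N + 1))⁻¹) * (A + |l|) < z - l := by
    have ht : Tendsto (fun η : ℝ => (1 - ((1 + η * r₀) ^ (N + 1))⁻¹) * (A + |l|)) (𝓝 0) (𝓝 0) := by
      have hc : ContinuousAt (fun η : ℝ => (1 - ((1 + η * r₀) ^ (N + 1))⁻¹) * (A + |l|)) 0 := by
        refine ContinuousAt.mul (ContinuousAt.sub continuousAt_const
          (ContinuousAt.inv₀ (by fun_prop) (by simp))) continuousAt_const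
      simpa [ContinuousAt] using hc
    have hev := (ht.mono_left (nhdsWithin_le_nhds (s := Ioi 0))).eventually_lt_const
      (sub_pos.2 hlz)
    obtain ⟨η, h1, h2⟩ := (hev.and eventually_mem_nhdsWithin).exists
    exact ⟨η, h2, h1⟩
  obtain ⟨η, hη, hηz⟩ := hη
  set θ : ℝ := ((1 + η * r₀) ^ (N + 1))⁻¹ with hθd
  have hθ0 : 0 < θ := by positivity
  have hθ1 : θ ≤ 1 :=
    inv_le_one_of_one_le₀ (one_le_pow₀ (le_add_of_nonneg_right (by positivity)))
  let ψ : EuclideanSpace ℝ (Fin N) → ℝ := fun x => φ x * decayWeight η x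
  have hw0 := fun x => decayWeight_pos (N := N) hη x
  have hψ0 : ∀ x ∈ Ω, 0 ≤ ψ x := fun x hx => mul_nonneg (hφ0 x hx) (hw0 x).le
  have hψc : ContinuousOn ψ Ω := hφc.mul (continuous_decayWeight hη).continuousOn
  have hψB : ∀ x ∈ Ω, |ψ x| ≤ B := fun x hx => by
    rw [abs_mul, abs_of_pos (hw0 x)]
    exact (mul_le_of_le_one_right (abs_nonneg _) (decayWeight_le_one hη x)).trans (hB x hx)
  have hψi : Integrable ψ (volume.restrict Ω) :=
    (integrable_decayWeight hη).integrableOn.bdd_mul (hφc.aestronglyMeasurable hΩm) (c := B)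
      ((ae_restrict_iff' hΩm).2 (.of_forall hB))
  have hψm := hψc.aestronglyMeasurable (μ := volume) hΩm
  have hψ2 : MemLp ψ 2 (volume.restrict Ω) := by
    rw [memLp_two_iff_integrable_sq hψm]
    simp only [sq]
    exact hψi.bdd_mul hψm (c := B) ((ae_restrict_iff' hΩm).2 (.of_forall hψB))
  have hψne : ¬ ψ =ᵐ[volume.restrict Ω] 0 := fun h => by
    have := Measure.eqOn_open_of_ae_eq h hK.isOpen hψc continuousOn_const hx₀
    exact mul_ne_zero hφx₀ (hw0 x₀).ne' this
  have hφi : IntegrableOnBounded Ω φ := .of_continuousOn_bound hK.isOpen hφc hB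
  have hψib : IntegrableOnBounded Ω ψ := .of_continuousOn_bound hK.isOpen hψc hψB
  have hL : ∀ x ∈ Ω, θ * decayWeight η x * nonlocalOp Ω K φ x ≤ nonlocalOp Ω K ψ x := by
    intro x hx
    rw [nonlocalOp, ← integral_const_mul]
    refine setIntegral_mono_on ((hK.integrableOn_mul hφi hx).const_mul _)
      (hK.integrableOn_mul hψib hx) hΩm fun y hy => ?_
    by_cases hxy : dist y x < r₀
    · have h1 := mul_le_mul_of_nonneg_right (mul_decayWeight_le hη hr hxy)
        (mul_nonneg (hK.nonneg x hx y hy) (hφ0 y hy))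
      exact h1.trans_eq (by simp only [ψ]; ring)
    · simp [hK.eq_zero x hx y hy (not_lt.1 hxy)]
  have hint : Integrable (fun x => (nonlocalOp Ω K ψ x + a x * ψ x) * ψ x)
      (volume.restrict Ω) := by
    refine hψi.bdd_mul
      (((hK.continuousOn_nonlocalOp hψib).add ((hac.mono subset_closure).mul
        hψc)).aestronglyMeasurable hΩm)
      (c := C₀ * volume.real (Metric.ball (0 : EuclideanSpace ℝ (Fin N)) r₀) * B + A * B)
      ((ae_restrict_iff' hΩm).2 (.of_forall fun x hx => ?_))
    refine (norm_add_le _ _).trans (add_le_add (hK.abs_nonlocalOp_le hψB hx) ?_)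
    rw [norm_mul]
    exact mul_le_mul (hA x hx) (hψB x hx) (norm_nonneg _) ((abs_nonneg _).trans (hA x hx))
  have hmain : -z * ∫ x in Ω, ψ x ^ 2 ≤ ∫ x in Ω, (nonlocalOp Ω K ψ x + a x * ψ x) * ψ x := by
    rw [← integral_const_mul]
    refine setIntegral_mono_on (hψ2.integrable_sq.const_mul _) hint hΩm fun x hx => ?_
    have h1 : θ * decayWeight η x * (-(a x + l) * φ x) ≤ nonlocalOp Ω K ψ x := by
      refine le_trans ?_ (hL x hx)
      have := hφ x hx
      have := hw0 x
      gcongr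
      linarith
    have h2 : -z ≤ -l + (1 - θ) * (a x + l) := by
      have h3 : -(A + |l|) ≤ a x + l := by
        have h4 := neg_abs_le (a x)
        have h5 := hA x hx
        have h6 := neg_abs_le l
        linarith
      have h7 := mul_le_mul_of_nonneg_left h3 (sub_nonneg.2 hθ1)
      linarith
    calc -z * ψ x ^ 2 ≤ (-l + (1 - θ) * (a x + l)) * ψ x ^ 2 :=
          mul_le_mul_of_nonneg_right h2 (sq_nonneg _)
      _ = (θ * decayWeight η x * (-(a x + l) * φ x) + a x * ψ x) * ψ x := by
          simp only [ψ]; ring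
      _ ≤ _ := mul_le_mul_of_nonneg_right (by linarith) (hψ0 x hx)
  have hle : lambdaV Ω K a ≤ ((-((∫ x in Ω, (nonlocalOp Ω K ψ x + a x * ψ x) * ψ x) /
      ∫ x in Ω, ψ x ^ 2) : ℝ) : EReal) := sInf_le ⟨ψ, ⟨hψ2, hψne⟩, rfl⟩
  refine hle.trans (EReal.coe_le_coe_iff.2 ?_)
  rw [neg_le, le_div_iff₀ (integral_sq_pos hψ2 hψne)]
  exact hmain

end IsFiniteRangeKernel

/-! ### Symmetric kernels: supersolutions and the quadratic form -/

namespace IsFiniteRangeKernel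

/-- A Carathéodory kernel is jointly measurable. -/
lemma aemeasurable_uncurry (hK : IsFiniteRangeKernel Ω K r₀ r₁ C₀ c₀) :
    AEMeasurable (Function.uncurry K) ((volume.restrict Ω).prod (volume.restrict Ω)) := by
  have hΩm : MeasurableSet Ω := hK.isOpen.measurableSet
  rcases Ω.eq_empty_or_nonempty with rfl | hne
  · simp
  have : Nonempty Ω := hne.to_subtype
  let d : ℕ → Ω := TopologicalSpace.denseSeq Ω
  have hd := fun i => hK.aemeasurable (d i) (d i).2
  have hae : ∀ᵐ y ∂(volume.restrict Ω), UniformContinuousOn (fun x => K x y) Ω ∧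
      ∀ i, K (d i) y = (hd i).mk _ y :=
    hK.uniformContinuousOn.and (ae_all_iff.2 fun i => (hd i).ae_eq_mk)
  obtain ⟨G, hGsub, hGm, hG⟩ := hae.exists_measurable_mem
  let k : Ω → EuclideanSpace ℝ (Fin N) → ℝ := fun x y => G.indicator (fun y => K x y) y
  have hkc : ∀ y, Continuous fun x => k x y := fun y => by
    by_cases hy : y ∈ G
    · simp only [k, indicator_of_mem hy]
      exact continuousOn_iff_continuous_domRestrict.1 (hG y hy).1.continuousOn
    · simp only [k, indicator_of_notMem hy]
      exact continuous_const
  have hkd : ∀ i, Measurable (k (d i)) := fun i => by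
    have : k (d i) = G.indicator ((hd i).mk _) := by
      ext y
      by_cases hy : y ∈ G
      · simp only [k, indicator_of_mem hy, (hG y hy).2 i]
      · simp only [k, indicator_of_notMem hy]
    rw [this]
    exact (hd i).measurable_mk.indicator hGm
  have hkm : ∀ x, Measurable (k x) := fun x => by
    obtain ⟨s, hs, hsx⟩ := mem_closure_iff_seq_limit.1
      ((TopologicalSpace.denseRange_denseSeq Ω) x)
    refine measurable_of_tendsto_metrizable (f := fun n => k (s n)) (fun n => ?_)
      (tendsto_pi_nhds.2 fun y => ((hkc y).tendsto x).comp hsx)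
    obtain ⟨i, hi⟩ := hs n
    rw [← hi]
    exact hkd i
  have hku : Measurable (Function.uncurry k) :=
    measurable_uncurry_of_continuous_of_measurable hkc hkm
  have hemb : MeasurableEmbedding (Prod.map ((↑) : Ω → EuclideanSpace ℝ (Fin N))
      (id : EuclideanSpace ℝ (Fin N) → EuclideanSpace ℝ (Fin N))) :=
    (MeasurableEmbedding.subtype_coe hΩm).prodMap MeasurableEmbedding.id
  refine ⟨_, hemb.measurable_extend hku (measurable_const (a := (0 : ℝ))), ?_⟩
  have h1 : ∀ᵐ p ∂((volume.restrict Ω).prod (volume.restrict Ω)), p.1 ∈ Ω :=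
    Measure.quasiMeasurePreserving_fst.ae (ae_restrict_mem hΩm)
  have h2 : ∀ᵐ p ∂((volume.restrict Ω).prod (volume.restrict Ω)), p.2 ∈ G :=
    Measure.quasiMeasurePreserving_snd.ae hGsub
  filter_upwards [h1, h2] with p hp1 hp2
  have : p = Prod.map ((↑) : Ω → EuclideanSpace ℝ (Fin N)) id (⟨p.1, hp1⟩, p.2) := rfl
  rw [this, hemb.injective.extend_apply]
  simp [k, indicator_of_mem hp2, Function.uncurry_def]

/-- Symmetry makes a positive supersolution control the quadratic form, by
`ψ(x) ψ(y) ≤ (φ(y) / φ(x) ψ(x)² + φ(x) / φ(y) ψ(y)²) / 2`. -/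
lemma integral_le_of_supersolution (hK : IsFiniteRangeKernel Ω K r₀ r₁ C₀ c₀)
    (hsymm : ∀ x ∈ Ω, ∀ y ∈ Ω, K x y = K y x) (ha : IsAdmissiblePotential Ω a)
    {l : ℝ} {φ ψ : EuclideanSpace ℝ (Fin N) → ℝ} (hφc : ContinuousOn φ (closure Ω))
    (hφ0 : ∀ x ∈ closure Ω, 0 < φ x)
    (hφ : ∀ x ∈ Ω, nonlocalOp Ω K φ x + a x * φ x + l * φ x ≤ 0)
    (hψ : MemLp ψ 2 (volume.restrict Ω)) :
    ∫ x in Ω, (nonlocalOp Ω K ψ x + a x * ψ x) * ψ x ≤ -l * ∫ x in Ω, ψ x ^ 2 := by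
  obtain ⟨hac, A, hA⟩ := ha
  have hΩm : MeasurableSet Ω := hK.isOpen.measurableSet
  set ν := (volume.restrict Ω : Measure (EuclideanSpace ℝ (Fin N)))
  have hφp : ∀ x ∈ Ω, 0 < φ x := fun x hx => hφ0 x (subset_closure hx)
  have hφi : IntegrableOnBounded Ω φ := .of_continuousOn_closure hK.isOpen hφc
  have hψi : IntegrableOnBounded Ω ψ := .of_memLp hψ
  have hφm : AEStronglyMeasurable φ ν := hφi.aestronglyMeasurable
  have haψ : Integrable (fun x => a x * ψ x ^ 2) ν :=
    hψ.integrable_sq.bdd_mul ((hac.mono subset_closure).aestronglyMeasurable hΩm) (c := A)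
      ((ae_restrict_iff' hΩm).2 (.of_forall hA))
  have hKm : AEStronglyMeasurable (fun p : _ × _ => K p.1 p.2) (ν.prod ν) :=
    hK.aemeasurable_uncurry.aestronglyMeasurable
  have hmem : ∀ᵐ p ∂(ν.prod ν), p.1 ∈ Ω ∧ p.2 ∈ Ω :=
    (Measure.quasiMeasurePreserving_fst.ae (ae_restrict_mem hΩm)).and
      (Measure.quasiMeasurePreserving_snd.ae (ae_restrict_mem hΩm))
  let H : EuclideanSpace ℝ (Fin N) × EuclideanSpace ℝ (Fin N) → ℝ :=
    fun p => K p.1 p.2 * φ p.2 * (ψ p.1 ^ 2 / φ p.1)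
  have hHx : ∀ x, ∫ y, H (x, y) ∂ν = nonlocalOp Ω K φ x * (ψ x ^ 2 / φ x) := fun x =>
    integral_mul_const (ψ x ^ 2 / φ x) fun y => K x y * φ y
  have hHle : ∀ x ∈ Ω, nonlocalOp Ω K φ x * (ψ x ^ 2 / φ x) ≤ -(a x * ψ x ^ 2) - l * ψ x ^ 2 :=
    fun x hx => by
    have h1 : nonlocalOp Ω K φ x ≤ -(a x + l) * φ x := by have := hφ x hx; linarith
    have h2 : 0 ≤ ψ x ^ 2 / φ x := div_nonneg (sq_nonneg _) (hφp x hx).le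
    refine (mul_le_mul_of_nonneg_right h1 h2).trans_eq ?_
    have := (hφp x hx).ne'
    field_simp
    ring
  have hdom : Integrable (fun x => -(a x * ψ x ^ 2) - l * ψ x ^ 2) ν :=
    haψ.neg.sub (hψ.integrable_sq.const_mul l)
  have hLφ0 : ∀ x ∈ Ω, 0 ≤ nonlocalOp Ω K φ x * (ψ x ^ 2 / φ x) := fun x hx =>
    mul_nonneg (hK.nonlocalOp_nonneg (fun y hy => (hφp y hy).le) hx)
      (div_nonneg (sq_nonneg _) (hφp x hx).le)
  have hLφm : AEStronglyMeasurable (fun x => nonlocalOp Ω K φ x * (ψ x ^ 2 / φ x)) ν :=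
    ((hK.continuousOn_nonlocalOp hφi).aestronglyMeasurable hΩm).mul
      ((hψ.1.pow 2).div₀ hφm)
  have hLφi : Integrable (fun x => nonlocalOp Ω K φ x * (ψ x ^ 2 / φ x)) ν := by
    refine hdom.mono' hLφm ((ae_restrict_iff' hΩm).2 (.of_forall fun x hx => ?_))
    rw [Real.norm_of_nonneg (hLφ0 x hx)]
    exact hHle x hx
  have hHi : Integrable H (ν.prod ν) := by
    refine (integrable_prod_iff ?_).2 ⟨?_, ?_⟩
    · exact (hKm.mul hφm.comp_snd).mul ((hψ.1.comp_fst.pow 2).div₀ hφm.comp_fst)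
    · exact (ae_restrict_iff' hΩm).2 (.of_forall fun x hx =>
        (hK.integrableOn_mul hφi hx).mul_const (ψ x ^ 2 / φ x))
    · refine hLφi.congr ((ae_restrict_iff' hΩm).2 (.of_forall fun x hx => ?_))
      simp only
      rw [← hHx]
      refine setIntegral_congr_fun hΩm fun y hy => ?_
      exact (Real.norm_of_nonneg (mul_nonneg (mul_nonneg (hK.nonneg x hx y hy) (hφp y hy).le)
        (div_nonneg (sq_nonneg _) (hφp x hx).le))).symm
  have hHs : Integrable (fun p => H p.swap) (ν.prod ν) := hHi.swap
  let F : EuclideanSpace ℝ (Fin N) × EuclideanSpace ℝ (Fin N) → ℝ :=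
    fun p => K p.1 p.2 * ψ p.2 * ψ p.1
  have hFm : AEStronglyMeasurable F (ν.prod ν) := (hKm.mul hψ.1.comp_snd).mul hψ.1.comp_fst
  have hFle : ∀ᵐ p ∂(ν.prod ν), |F p| ≤ (H p + H p.swap) / 2 := by
    filter_upwards [hmem] with p hp
    obtain ⟨x, y⟩ := p
    obtain ⟨hx, hy⟩ := hp
    simp only [F, H, Prod.swap]
    rw [hsymm y hy x hx, mul_assoc, abs_mul, abs_of_nonneg (hK.nonneg x hx y hy)]
    have hx0 := hφp x hx
    have hy0 := hφp y hy
    have key : |ψ y * ψ x| ≤ (φ y * (ψ x ^ 2 / φ x) + φ x * (ψ y ^ 2 / φ y)) / 2 := by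
      rw [abs_mul]
      have h1 : φ y * (ψ x ^ 2 / φ x) + φ x * (ψ y ^ 2 / φ y) - 2 * (|ψ y| * |ψ x|) =
          (φ y * |ψ x| - φ x * |ψ y|) ^ 2 / (φ x * φ y) := by
        rw [← sq_abs (ψ x), ← sq_abs (ψ y)]
        field_simp
        ring
      have h2 : 0 ≤ (φ y * |ψ x| - φ x * |ψ y|) ^ 2 / (φ x * φ y) := by positivity
      linarith
    refine (mul_le_mul_of_nonneg_left key (hK.nonneg x hx y hy)).trans_eq ?_
    ring
  have hGi : Integrable (fun p => (H p + H p.swap) / 2) (ν.prod ν) := (hHi.add hHs).div_const 2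
  have hFi : Integrable F (ν.prod ν) := hGi.mono' hFm hFle
  have hFx : ∀ x, ∫ y, F (x, y) ∂ν = nonlocalOp Ω K ψ x * ψ x := fun x =>
    integral_mul_const (ψ x) fun y => K x y * ψ y
  have hLψ : Integrable (fun x => nonlocalOp Ω K ψ x * ψ x) ν := by
    simpa only [hFx] using hFi.integral_prod_left
  have hquad : ∫ x, nonlocalOp Ω K ψ x * ψ x ∂ν ≤
      ∫ x, nonlocalOp Ω K φ x * (ψ x ^ 2 / φ x) ∂ν :=
    calc ∫ x, nonlocalOp Ω K ψ x * ψ x ∂ν = ∫ p, F p ∂(ν.prod ν) := by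
          rw [integral_prod _ hFi]; simp only [hFx]
      _ ≤ ∫ p, (H p + H p.swap) / 2 ∂(ν.prod ν) :=
          integral_mono_ae hFi hGi (hFle.mono fun p hp => (le_abs_self _).trans hp)
      _ = ∫ p, H p ∂(ν.prod ν) := by
          rw [integral_div, integral_add hHi hHs, integral_prod_swap]
          ring
      _ = _ := by rw [integral_prod _ hHi]; simp only [hHx]
  calc ∫ x, (nonlocalOp Ω K ψ x + a x * ψ x) * ψ x ∂ν
      = ∫ x, nonlocalOp Ω K ψ x * ψ x ∂ν + ∫ x, a x * ψ x ^ 2 ∂ν := by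
        rw [← integral_add hLψ haψ]
        congr 1
        ext x
        ring
    _ ≤ ∫ x, (-(a x * ψ x ^ 2) - l * ψ x ^ 2) ∂ν + ∫ x, a x * ψ x ^ 2 ∂ν := by
        exact add_le_add_left (hquad.trans (setIntegral_mono_on hLφi hdom hΩm hHle)) _
    _ = -l * ∫ x, ψ x ^ 2 ∂ν := by
        rw [← integral_add hdom haψ, ← integral_const_mul]
        congr 1
        ext x
        ring

lemma lambdaP_le_lambdaV (hK : IsFiniteRangeKernel Ω K r₀ r₁ C₀ c₀)
    (hsymm : ∀ x ∈ Ω, ∀ y ∈ Ω, K x y = K y x) (ha : IsAdmissiblePotential Ω a) :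
    lambdaP Ω K a ≤ lambdaV Ω K a := by
  refine sSup_le ?_
  rintro _ ⟨l, ⟨φ, hφc, hφ0, hφ⟩, rfl⟩
  refine le_sInf ?_
  rintro _ ⟨ψ, ⟨hψ, hψne⟩, rfl⟩
  refine EReal.coe_le_coe_iff.2 ?_
  rw [le_neg, div_le_iff₀ (integral_sq_pos hψ hψne)]
  exact hK.integral_le_of_supersolution hsymm ha hφc hφ0 hφ hψ

end IsFiniteRangeKernel
end

end NonlocalEigenvalue

end

theorem theorem2 (N : ℕ) (Ω : Set (EuclideanSpace ℝ (Fin N)))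
    (hΩ_open : IsOpen Ω) (hΩ_conn : IsConnected Ω) (hΩ_unbdd : ¬ Bornology.IsBounded Ω)
    (K : EuclideanSpace ℝ (Fin N) → EuclideanSpace ℝ (Fin N) → ℝ)
    (a : EuclideanSpace ℝ (Fin N) → ℝ)
    (ha : NonlocalEigenvalue.IsAdmissiblePotential Ω a)
    (hK : NonlocalEigenvalue.IsNonnegCaratheodory Ω K)
    (hK_nondeg : NonlocalEigenvalue.IsNondegenerate Ω K) :
    (NonlocalEigenvalue.lambdaPPrime Ω K a ≤ NonlocalEigenvalue.lambdaPSecond Ω K a ∧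
      NonlocalEigenvalue.lambdaPSecond Ω K a ≤ NonlocalEigenvalue.lambdaP Ω K a) ∧
    ((∀ x ∈ Ω, ∀ y ∈ Ω, K x y = K y x) →
      MemLp (fun x => ∫ y in Ω, K x y) ⊤ (volume.restrict Ω) →
      NonlocalEigenvalue.lambdaV Ω K a = NonlocalEigenvalue.lambdaPPrime Ω K a ∧
      NonlocalEigenvalue.lambdaPPrime Ω K a = NonlocalEigenvalue.lambdaPSecond Ω K a ∧
      NonlocalEigenvalue.lambdaPSecond Ω K a = NonlocalEigenvalue.lambdaP Ω K a) := by
  obtain ⟨r₀, r₁, C₀, c₀, hK'⟩ := hK_nondeg.exists_isFiniteRangeKernel hK hΩ_open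
  have h1 := NonlocalEigenvalue.lambdaPPrime_le_lambdaPSecond (Ω := Ω) K a
  have h2 := hK'.lambdaPSecond_le_lambdaP hΩ_conn ha
  refine ⟨⟨h1, h2⟩, fun hsymm _ => ?_⟩
  have h3 := hK'.lambdaP_le_lambdaV hsymm ha
  have h4 := hK'.lambdaV_le_lambdaPPrime ha
  exact ⟨h4.antisymm (h1.trans (h2.trans h3)), h1.antisymm (h2.trans (h3.trans h4)),
    h2.antisymm (h3.trans (h4.trans h1))⟩
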